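/- **Conventions.** A *regular cardinal* is either $0$ or an infinite cardinal equal to its own cofinality. An *exact category* is an additive category $\mathsf E$ with Hom sets, endowed with a Quillen exact structure; an *admissible monomorphism* (*epimorphism*) is the first (second) morphism of a short exact sequence, and an *admissible subobject* is the source of an admissible monomorphism. $\mathsf E$ is *weakly idempotent-complete* if every pair $i\colon A\to B$, $p\colon B\to A$ with $pi=\mathrm{id}_A$ is, up to an isomorphism $B\simeq A\oplus C$, the inclusion of and the projection onto a direct summand. An *object size function* assigns to every object $X\in\mathsf E$ a regular cardinal $\psi(X)$ such that, writing $\mathsf E_\lambda$ for the full subcategory of all $X$ with $\psi(X)\le\lambda$, the following hold for every regular cardinal $\lambda$: (i) $\psi(0)=0$, and $\psi$ is invariant under isomorphisms; (ii) there is only a set of isomorphism classes of objects in $\mathsf E_\lambda$; (iii) $\mathsf E_\lambda$ is closed under extensions; (iv) for any family of fewer than $\lambda$ morphisms $A_i\to B$ with $A_i\in\mathsf E_\lambda$, there is an admissible subobject $D\subset B$, $D\in\mathsf E_\lambda$, through which all of them factorize; (v) for any admissible epimorphism $B\to C$ with $C\in\mathsf E_\lambda$ there is an admissible subobject $D\subset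 B$, $D\in\mathsf E_\lambda$, such that $D\to B\to C$ is an admissible epimorphism. Let $\phi(\lambda)$ be the least regular cardinal such that $\psi(K)\le\phi(\lambda)$ for every kernel $K$ of an admissible epimorphism between objects of $\mathsf E_\lambda$. Put $\phi_0(\lambda)=0$ and $\phi^0(\lambda)=\lambda$; for an ordinal $\beta$ put $\phi_{\beta+1}(\lambda)=\phi^\beta(\lambda)$; for a limit ordinal $\alpha$ let $\phi_\alpha(\lambda)$ be the least regular cardinal that is $\ge\phi^\beta(\lambda)$ for all $\beta<\alpha$; and put $\phi^\alpha(\lambda)=\phi(\phi_\alpha(\lambda))$ for all $\alpha>0$. A *chain of admissible monomorphisms* is an inductive system indexed by an ordinal all of whose transition morphisms are admissible monomorphisms. For an infinite regular cardinal $\kappa$, consider the following conditions. (vi) For every chain of admissible monomorphisms $(E_i)_{0\le i\le\alpha}$ with $\operatorname{cof}(\alpha)\ge\kappa$, the colimit $\varinjlim_{i<\alpha}E_i$ exists. (vii) For every inductive system of short exact sequences $0\to A_i\to B_i\to C_i\to0$ indexed by $i<\alpha$, $\operatorname{cof}(\alpha)\ge\kappa$, in which $(A_i)$, $(B_i)$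 and $(C_i)$ are chains of admissible monomorphisms whose colimits exist, the sequence $0\to\varinjlim A_i\to\varinjlim B_i\to\varinjlim C_i\to0$ is short exact. (viii) For every regular cardinal $\lambda>\kappa$ and every chain of admissible monomorphisms $(E_i)_{0\le i\le\alpha}$ with $\kappa\le\operatorname{cof}(\alpha)<\lambda$ and $E_i\in\mathsf E_\lambda$ for all $i<\alpha$, one has $\varinjlim_{i<\alpha}E_i\in\mathsf E_\lambda$. (ix) For every chain of admissible monomorphisms $(E_i)_{0\le i\le\alpha}$ with $\operatorname{cof}(\alpha)\ge\kappa$, the natural morphism $\varinjlim_{i<\alpha}E_i\to E_\alpha$ is an admissible monomorphism. A complex $M^\bullet$ in $\mathsf E$ is *exact* if there are objects $N^n$ and short exact sequences $0\to N^n\to M^n\to N^{n+1}\to0$ such that each differential is the composition $M^n\to N^{n+1}\to M^{n+1}$; it is an *exact complex in $\mathsf E_\mu$* if moreover the $M^n$ and $N^n$ can be taken in $\mathsf E_\mu$. The derived category $\mathsf D(\mathsf E)$ is the Verdier quotient of the homotopy category of unbounded complexes $\mathsf K(\mathsf E)$ by the exact complexes. **Theorem.** Let $\kappa$ be an infinite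 regular cardinal, let $\mathsf E$ be a weakly idempotent-complete exact category satisfying (vi) and (vii), and let $\psi$ be an object size function on $\mathsf E$ satisfying (viii). (a) Let $\lambda>\kappa$ be a regular cardinal and put $\mu=\phi_\kappa(\lambda)$. Let $K^\bullet$ be a complex with all terms in $\mathsf E_\lambda$, let $M^\bullet$ be an exact complex in $\mathsf E$, and let $g\colon K^\bullet\to M^\bullet$ be a morphism of complexes. Then there are an exact complex $L^\bullet$ in $\mathsf E_\mu$ and morphisms of complexes $k\colon K^\bullet\to L^\bullet$ and $m\colon L^\bullet\to M^\bullet$ with $g=mk$; and if $\mathsf E$ also satisfies (ix), then every component $m^n\colon L^n\to M^n$ is an admissible monomorphism. (b) $\mathsf D(\mathsf E)$ has Hom sets: the morphisms between any two given objects of $\mathsf D(\mathsf E)$ form a set. -/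

import Mathlib

universe v u

open CategoryTheory CategoryTheory.Limits

/-- `f` is the first morphism of a sequence in the class `P`. -/
def IsAdmMonoFor {C : Type u} [Category.{v} C] [Preadditive C] (P : ShortComplex C → Prop)
    {A B : C} (f : A ⟶ B) : Prop :=
  ∃ (Z : C) (p : B ⟶ Z) (w : f ≫ p = 0), P (ShortComplex.mk f p w)

/-- `g` is the second morphism of a sequence in the class `P`. -/
def IsAdmEpiFor {C : Type u} [Category.{v} C] [Preadditive C] (P : ShortComplex C → Prop)
    {B Z : C} (g : B ⟶ Z) : Prop :=
  ∃ (A : C) (i : A ⟶ B) (w : i ≫ g = 0), P (ShortComplex.mk i g w)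

/-- A Quillen exact structure on an additive category: a class of kernel-cokernel pairs (the short
exact sequences, or conflations), closed under isomorphisms, such that admissible monomorphisms and
admissible epimorphisms contain the identities, are stable under composition, and are stable
under pushouts along arbitrary morphisms, respectively under pullbacks along arbitrary morphisms
(these pushouts and pullbacks being required to exist). -/
structure ExactStructure (C : Type u) [Category.{v} C] [Preadditive C] [HasZeroObject C]
    [HasBinaryBiproducts C] where
  /-- the class of short exact sequences -/
  conflation : ShortComplex C → Prop
  isKernel : ∀ S, conflation S → Nonempty (IsLimit (KernelFork.ofι S.f S.zero))
  isCokernel : ∀ S, conflation S → Nonempty (IsColimit (CokernelCofork.ofπ S.g S.zero))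
  of_iso : ∀ S T : ShortComplex C, Nonempty (S ≅ T) → conflation S → conflation T
  id_mono : ∀ A : C, IsAdmMonoFor conflation (𝟙 A)
  id_epi : ∀ A : C, IsAdmEpiFor conflation (𝟙 A)
  comp_mono : ∀ {X Y Z : C} (f : X ⟶ Y) (g : Y ⟶ Z),
    IsAdmMonoFor conflation f → IsAdmMonoFor conflation g → IsAdmMonoFor conflation (f ≫ g)
  comp_epi : ∀ {X Y Z : C} (f : X ⟶ Y) (g : Y ⟶ Z),
    IsAdmEpiFor conflation f → IsAdmEpiFor conflation g → IsAdmEpiFor conflation (f ≫ g)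
  pushout_mono : ∀ {A B A' : C} (f : A ⟶ B) (h : A ⟶ A'), IsAdmMonoFor conflation f →
    ∃ (B' : C) (f' : A' ⟶ B') (k : B ⟶ B'), IsPushout f h k f' ∧ IsAdmMonoFor conflation f'
  pullback_epi : ∀ {B Z Z' : C} (g : B ⟶ Z) (h : Z' ⟶ Z), IsAdmEpiFor conflation g →
    ∃ (B' : C) (g' : B' ⟶ Z') (k : B' ⟶ B), IsPullback k g' g h ∧ IsAdmEpiFor conflation g'

/-- Every split monomorphism `i : A ⟶ B` with retraction `p` is, up to an isomorphism
`B ≅ A ⊞ X`, the inclusion of a direct summand, with `p` the projection. -/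
def WeaklyIdempotentComplete (C : Type u) [Category.{v} C] [Preadditive C]
    [HasBinaryBiproducts C] : Prop :=
  ∀ {A B : C} (i : A ⟶ B) (p : B ⟶ A), i ≫ p = 𝟙 A →
    ∃ (X : C) (e : B ≅ A ⊞ X), i ≫ e.hom = biprod.inl ∧ e.hom ≫ biprod.fst = p

/-- Regular cardinals, where the cardinal `0` is admitted as regular (Mathlib's `IsRegular` only
admits infinite cardinals). -/
def IsRegularOrZero (c : Cardinal.{v}) : Prop := c = 0 ∨ c.IsRegular

/-- The least regular cardinal that is an upper bound of `s`. -/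
noncomputable def leastRegularBound (s : Set Cardinal.{v}) : Cardinal.{v} :=
  sInf {c | IsRegularOrZero c ∧ ∀ a ∈ s, a ≤ c}

namespace ExactStructure

variable {C : Type u} [Category.{v} C] [Preadditive C] [HasZeroObject C] [HasBinaryBiproducts C]
  (E : ExactStructure C)

/-- Admissible monomorphisms. -/
def IsAdmMono {A B : C} (f : A ⟶ B) : Prop :=
  IsAdmMonoFor E.conflation f

/-- Admissible epimorphisms. -/
def IsAdmEpi {B Z : C} (g : B ⟶ Z) : Prop :=
  IsAdmEpiFor E.conflation g

/-- `ψ` is an object size function on the exact category; the full subcategory `E_lam` consists of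
the objects `X` with `ψ X ≤ lam`. "Set" means "small with respect to the universe of the
morphisms", as for the Hom sets of the category. -/
structure IsSizeFunction (ψ : C → Cardinal.{v}) : Prop where
  regular : ∀ X, IsRegularOrZero (ψ X)
  zero : ∀ X, IsZero X → ψ X = 0
  iso : ∀ X Y, Nonempty (X ≅ Y) → ψ X = ψ Y
  small : ∀ lam, IsRegularOrZero lam →
    ObjectProperty.EssentiallySmall.{v} (fun X : C => ψ X ≤ lam)
  extension : ∀ lam, IsRegularOrZero lam → ∀ S, E.conflation S →
    ψ S.X₁ ≤ lam → ψ S.X₃ ≤ lam → ψ S.X₂ ≤ lam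
  factor : ∀ lam, IsRegularOrZero lam → ∀ (B : C) (I : Type v), Cardinal.mk I < lam →
    ∀ (A : I → C) (f : ∀ i, A i ⟶ B), (∀ i, ψ (A i) ≤ lam) →
      ∃ (D : C) (d : D ⟶ B), E.IsAdmMono d ∧ ψ D ≤ lam ∧ ∀ i, ∃ g : A i ⟶ D, g ≫ d = f i
  cover : ∀ lam, IsRegularOrZero lam → ∀ (B Z : C) (g : B ⟶ Z), E.IsAdmEpi g → ψ Z ≤ lam →
    ∃ (D : C) (d : D ⟶ B), E.IsAdmMono d ∧ ψ D ≤ lam ∧ E.IsAdmEpi (d ≫ g)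

/-- `phi lam` is the least regular cardinal such that `ψ K ≤ phi lam` for every kernel `K` of an
admissible epimorphism between objects of `E_lam`. -/
noncomputable def phi (ψ : C → Cardinal.{v}) (lam : Cardinal.{v}) : Cardinal.{v} :=
  leastRegularBound {a | ∃ S, E.conflation S ∧ ψ S.X₂ ≤ lam ∧ ψ S.X₃ ≤ lam ∧ a = ψ S.X₁}

/-- The cardinals `φ^α(lam)`: `φ^0(lam) = lam`, `φ^(β+1)(lam) = φ(φ^β(lam))`, and, for a limit
ordinal `α`, `φ^α(lam) = φ(c)` with `c` the least regular bound of all `φ^β(lam)`, `β < α`. -/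
noncomputable def phiUpper (ψ : C → Cardinal.{v}) (lam : Cardinal.{v}) (α : Ordinal.{v}) :
    Cardinal.{v} :=
  Ordinal.limitRecOn α lam (fun _ c => E.phi ψ c)
    (fun α _ c => E.phi ψ (leastRegularBound {a | ∃ (β : Ordinal.{v}) (h : β < α), a = c β h}))

/-- The cardinals `φ_α(lam)`: `φ_0(lam) = 0`, `φ_(β+1)(lam) = φ^β(lam)`, and, for a limit
ordinal `α`, the least regular bound of all `φ^β(lam)`, `β < α`. -/
noncomputable def phiLower (ψ : C → Cardinal.{v}) (lam : Cardinal.{v}) (α : Ordinal.{v}) :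
    Cardinal.{v} :=
  Ordinal.limitRecOn α 0 (fun β _ => E.phiUpper ψ lam β)
    (fun α _ _ => leastRegularBound {a | ∃ β < α, a = E.phiUpper ψ lam β})

/-- A chain of admissible monomorphisms indexed by the ordinals `i < α`. -/
def IsChain {α : Ordinal.{v}} (F : Set.Iio α ⥤ C) : Prop :=
  ∀ (i j : Set.Iio α) (h : i < j), E.IsAdmMono (F.map (homOfLE h.le))

/-- A cocone with vertex `X` and components admissible monomorphisms, over a chain of admissible
monomorphisms indexed by the ordinals `i < α`, is the same thing as a chain of admissible
monomorphisms indexed by the ordinals `i ≤ α` with last object `X`. -/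
def IsAdmCocone {α : Ordinal.{v}} {F : Set.Iio α ⥤ C} (c : Cocone F) : Prop :=
  ∀ i, E.IsAdmMono (c.ι.app i)

/-- Exact colimits of `κ`-directed chains of admissible monomorphisms. -/
structure HasExactChainColimits (κ : Cardinal.{v}) : Prop where
  hasColimit : ∀ (α : Ordinal.{v}), κ ≤ α.cof → ∀ (F : Set.Iio α ⥤ C), E.IsChain F →
    ∀ s : Cocone F, E.IsAdmCocone s → HasColimit F
  exact : ∀ (α : Ordinal.{v}), κ ≤ α.cof → ∀ (F : Set.Iio α ⥤ ShortComplex C),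
    (∀ i, E.conflation (F.obj i)) →
    E.IsChain (F ⋙ ShortComplex.π₁) → E.IsChain (F ⋙ ShortComplex.π₂) →
    E.IsChain (F ⋙ ShortComplex.π₃) →
    ∀ c : Cocone F, Nonempty (IsColimit (ShortComplex.π₁.mapCocone c)) →
      Nonempty (IsColimit (ShortComplex.π₂.mapCocone c)) →
      Nonempty (IsColimit (ShortComplex.π₃.mapCocone c)) → E.conflation c.pt

/-- Colimits of `κ`-directed chains of admissible monomorphisms preserve `ψ`. -/
def ChainColimitsPreserve (κ : Cardinal.{v}) (ψ : C → Cardinal.{v}) : Prop :=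
  ∀ lam : Cardinal.{v}, lam.IsRegular → κ < lam →
    ∀ (α : Ordinal.{v}), κ ≤ α.cof → α.cof < lam → ∀ (F : Set.Iio α ⥤ C), E.IsChain F →
    ∀ s : Cocone F, E.IsAdmCocone s → (∀ i, ψ (F.obj i) ≤ lam) →
    ∀ c : Cocone F, Nonempty (IsColimit c) → ψ c.pt ≤ lam

/-- Colimits of `κ`-directed chains of admissible subobjects of an object are admissible
subobjects of that object: for a chain of admissible monomorphisms indexed by the ordinals
`i ≤ α`, the natural morphism from the colimit over `i < α` to the last object is an admissible
monomorphism. -/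
def ChainColimitsAdmissible (κ : Cardinal.{v}) : Prop :=
  ∀ (α : Ordinal.{v}), κ ≤ α.cof → ∀ (F : Set.Iio α ⥤ C), E.IsChain F →
    ∀ s : Cocone F, E.IsAdmCocone s → ∀ (c : Cocone F) (hc : IsColimit c),
      E.IsAdmMono (hc.desc s)

/-- `M` is an exact complex in the full subcategory given by `P`: its terms belong to `P`, and
there are objects `Z n` in `P` and short exact sequences `0 ⟶ Z n ⟶ M n ⟶ Z (n + 1) ⟶ 0` such that
each differential is the composition `M n ⟶ Z (n + 1) ⟶ M (n + 1)`. -/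
def IsExactComplexIn (P : C → Prop) (M : CochainComplex C ℤ) : Prop :=
  (∀ n, P (M.X n)) ∧
  ∃ (Z : ℤ → C) (i : ∀ n, Z n ⟶ M.X n) (p : ∀ n, M.X n ⟶ Z (n + 1)) (w : ∀ n, i n ≫ p n = 0),
    (∀ n, P (Z n)) ∧ (∀ n, E.conflation (ShortComplex.mk (i n) (p n) (w n))) ∧
    ∀ n, p n ≫ i (n + 1) = M.d n (n + 1)

/-- Exact (acyclic) complexes. -/
def IsExactComplex (M : CochainComplex C ℤ) : Prop :=
  E.IsExactComplexIn (fun _ => True) M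

/-- The objects of the homotopy category that are isomorphic there to exact complexes. -/
def acyclic : ObjectProperty (HomotopyCategory C (ComplexShape.up ℤ)) :=
  fun X => ∃ M : CochainComplex C ℤ, E.IsExactComplex M ∧
    Nonempty (X ≅ (HomotopyCategory.quotient C (ComplexShape.up ℤ)).obj M)

/-- The derived category: the Verdier quotient of the homotopy category by the exact complexes,
that is, its localization at the morphisms with exact cones. -/
abbrev DerivedCat : Type _ := E.acyclic.trW.Localization

end ExactStructure

/-! Let `Z n` be the cycles of the exact complex `M`. A small exact subcomplex through which `K`
factors would need small subobjects of the `M.X n` and of the `Z n` that fit together in all degrees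
at once, and closing up in one degree disturbs its neighbours. The way out is to decouple the two
roles of the cycles. A `Stage` consists of short exact sequences `A n ⟶ L n ⟶ N (n + 1)` in which `A
n` and `N n` are two possibly different subobjects of `Z n`. Any family of fewer than `κ` stages has
an upper bound whose `A` contains the old `N` and whose `N` contains the old `A`
(`Stage.exists_upper_bound`). Iterating `κ` times gives interleaved chains, so the colimits of `A`
and `N` agree (`IsChainColimit.interleave`), and exactness of the colimit turns the sequences into
an exact complex (`exists_factorization`).

As for size, only passing to the kernel `A` raises the bound, by one application of `φ`. Hence every
stage stays below some `φ^β(λ)` with `β < κ`, and the colimit is bounded by `φ_κ(λ)`.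

For the Hom sets, a morphism out of `K` in the Verdier quotient is a right fraction whose
denominator `X' ⟶ K` has an exact cone `M`. Factor `K ⟶ M` through a small exact complex `L`. The
fibre of `K ⟶ L` maps to `X'` over `K`, so it may replace `X'`. Up to isomorphism there is only a
set of such `K ⟶ L`, hence only a set of fractions is needed (`small_hom`). This uses that the exact
complexes form a triangulated subcategory, for which the main point is `IsExactComplex.mappingCone`.
-/

namespace ExactStructure

variable {C : Type u} [Category.{v} C] [Preadditive C] [HasZeroObject C] [HasBinaryBiproducts C]
  {E : ExactStructure C}

/-! ### Elementary consequences of the axioms of an exact structure. -/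

section Basic

lemma exists_lift {A B Z : C} {f : A ⟶ B} {g : B ⟶ Z} {w : f ≫ g = 0}
    (h : E.conflation (ShortComplex.mk f g w)) {T : C} (t : T ⟶ B) (ht : t ≫ g = 0) :
    ∃ l : T ⟶ A, l ≫ f = t := by
  obtain ⟨hl⟩ := E.isKernel _ h
  obtain ⟨l, hl⟩ := KernelFork.IsLimit.lift' hl t ht
  exact ⟨l, hl⟩

lemma exists_desc {A B Z : C} {f : A ⟶ B} {g : B ⟶ Z} {w : f ≫ g = 0}
    (h : E.conflation (ShortComplex.mk f g w)) {T : C} (t : B ⟶ T) (ht : f ≫ t = 0) :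
    ∃ l : Z ⟶ T, g ≫ l = t := by
  obtain ⟨hl⟩ := E.isCokernel _ h
  obtain ⟨l, hl⟩ := CokernelCofork.IsColimit.desc' hl t ht
  exact ⟨l, hl⟩

lemma mono_of_conflation {A B Z : C} {f : A ⟶ B} {g : B ⟶ Z} {w : f ≫ g = 0}
    (h : E.conflation (ShortComplex.mk f g w)) : Mono f := by
  obtain ⟨hl⟩ := E.isKernel _ h
  exact mono_of_isLimit_fork hl

lemma epi_of_conflation {A B Z : C} {f : A ⟶ B} {g : B ⟶ Z} {w : f ≫ g = 0}
    (h : E.conflation (ShortComplex.mk f g w)) : Epi g := by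
  obtain ⟨hl⟩ := E.isCokernel _ h
  exact epi_of_isColimit_cofork hl

lemma IsAdmMono.mono {A B : C} {f : A ⟶ B} (h : E.IsAdmMono f) : Mono f := by
  obtain ⟨_, _, _, h⟩ := h
  exact mono_of_conflation h

lemma IsAdmEpi.epi {A B : C} {f : A ⟶ B} (h : E.IsAdmEpi f) : Epi f := by
  obtain ⟨_, _, _, h⟩ := h
  exact epi_of_conflation h

lemma conflation_of_isos {A B Z A' B' Z' : C} {f : A ⟶ B} {g : B ⟶ Z} {w : f ≫ g = 0}
    (h : E.conflation (ShortComplex.mk f g w)) {f' : A' ⟶ B'} {g' : B' ⟶ Z'} (w' : f' ≫ g' = 0)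
    (a : A ≅ A') (b : B ≅ B') (c : Z ≅ Z') (hf : a.hom ≫ f' = f ≫ b.hom)
    (hg : b.hom ≫ g' = g ≫ c.hom) : E.conflation (ShortComplex.mk f' g' w') :=
  E.of_iso _ _ ⟨ShortComplex.isoMk a b c hf hg⟩ h

/-- An admissible epimorphism forms a short exact sequence with any of its kernels. -/
lemma IsAdmEpi.conflation {A B Z : C} {f : A ⟶ B} {g : B ⟶ Z} (hg : E.IsAdmEpi g)
    (w : f ≫ g = 0) [Mono f] (hf : ∀ (T : C) (t : T ⟶ B), t ≫ g = 0 → ∃ l : T ⟶ A, l ≫ f = t) :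
    E.conflation (ShortComplex.mk f g w) := by
  obtain ⟨A', f', w', h⟩ := hg
  have := mono_of_conflation h
  obtain ⟨a, ha⟩ := hf _ f' w'
  obtain ⟨b, hb⟩ := exists_lift h f w
  refine conflation_of_isos h w ⟨a, b, ?_, ?_⟩ (Iso.refl _) (Iso.refl _) (by simp [ha]) (by simp)
  · rw [← cancel_mono f', Category.assoc, hb, ha, Category.id_comp]
  · rw [← cancel_mono f, Category.assoc, ha, hb, Category.id_comp]

/-- An admissible monomorphism forms a short exact sequence with any of its cokernels. -/
lemma IsAdmMono.conflation {A B Z : C} {f : A ⟶ B} {g : B ⟶ Z} (hf : E.IsAdmMono f)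
    (w : f ≫ g = 0) [Epi g] (hg : ∀ (T : C) (t : B ⟶ T), f ≫ t = 0 → ∃ l : Z ⟶ T, g ≫ l = t) :
    E.conflation (ShortComplex.mk f g w) := by
  obtain ⟨Z', g', w', h⟩ := hf
  have := epi_of_conflation h
  obtain ⟨a, ha⟩ := hg _ g' w'
  obtain ⟨b, hb⟩ := exists_desc h g w
  refine conflation_of_isos h w (Iso.refl _) (Iso.refl _) ⟨b, a, ?_, ?_⟩ (by simp) (by simp [hb])
  · rw [← cancel_epi g', reassoc_of% hb, ha, Category.comp_id]
  · rw [← cancel_epi g, reassoc_of% ha, hb, Category.comp_id]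

lemma isAdmMono_of_isos {A B A' B' : C} {f : A ⟶ B} (h : E.IsAdmMono f) {f' : A' ⟶ B'}
    (a : A ≅ A') (b : B ≅ B') (hf : a.hom ≫ f' = f ≫ b.hom) : E.IsAdmMono f' := by
  obtain ⟨Z, g, w, h⟩ := h
  have w' : f' ≫ b.inv ≫ g = 0 := by
    rw [← cancel_epi a.hom, reassoc_of% hf, b.hom_inv_id_assoc, w, comp_zero]
  exact ⟨Z, b.inv ≫ g, w', conflation_of_isos h w' a b (Iso.refl _) hf (by simp)⟩

lemma isAdmEpi_of_isos {A B A' B' : C} {f : A ⟶ B} (h : E.IsAdmEpi f) {f' : A' ⟶ B'}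
    (a : A ≅ A') (b : B ≅ B') (hf : a.hom ≫ f' = f ≫ b.hom) : E.IsAdmEpi f' := by
  obtain ⟨Z, g, w, h⟩ := h
  have w' : (g ≫ a.hom) ≫ f' = 0 := by
    rw [Category.assoc, hf, reassoc_of% w, zero_comp]
  exact ⟨Z, g ≫ a.hom, w', conflation_of_isos h w' (Iso.refl _) a b (by simp) hf⟩

variable (E)

lemma isAdmMono_of_isIso {A B : C} (f : A ⟶ B) [IsIso f] : E.IsAdmMono f :=
  isAdmMono_of_isos (E.id_mono A) (Iso.refl _) (asIso f) (by simp)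

lemma isAdmEpi_of_isIso {A B : C} (f : A ⟶ B) [IsIso f] : E.IsAdmEpi f :=
  isAdmEpi_of_isos (E.id_epi A) (Iso.refl _) (asIso f) (by simp)

lemma isAdmEpi_to_isZero {A Z : C} (hZ : IsZero Z) (f : A ⟶ Z) : E.IsAdmEpi f :=
  ⟨A, 𝟙 A, hZ.eq_of_tgt _ _, by
    have : Epi f := ⟨fun _ _ _ => hZ.eq_of_src _ _⟩
    exact IsAdmMono.conflation (E.id_mono A) _
      (fun T t ht => ⟨0, by rw [comp_zero, ← ht, Category.id_comp]⟩)⟩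

lemma isAdmMono_from_isZero {A Z : C} (hZ : IsZero Z) (f : Z ⟶ A) : E.IsAdmMono f :=
  ⟨A, 𝟙 A, hZ.eq_of_src _ _, by
    have : Mono f := ⟨fun _ _ _ => hZ.eq_of_tgt _ _⟩
    exact IsAdmEpi.conflation (E.id_epi A) _
      (fun T t ht => ⟨0, by rw [zero_comp, ← ht, Category.comp_id]⟩)⟩

variable {E}

lemma IsAdmMono.comp {X Y Z : C} {f : X ⟶ Y} {g : Y ⟶ Z} (hf : E.IsAdmMono f)
    (hg : E.IsAdmMono g) : E.IsAdmMono (f ≫ g) := E.comp_mono f g hf hg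

lemma IsAdmEpi.comp {X Y Z : C} {f : X ⟶ Y} {g : Y ⟶ Z} (hf : E.IsAdmEpi f)
    (hg : E.IsAdmEpi g) : E.IsAdmEpi (f ≫ g) := E.comp_epi f g hf hg

/-- The axiom supplies one pullback with the required property; every other one is isomorphic to it.
-/
lemma IsAdmEpi.of_isPullback {B Z B' Z' : C} {k : B' ⟶ B} {g' : B' ⟶ Z'} {g : B ⟶ Z} {h : Z' ⟶ Z}
    (hg : E.IsAdmEpi g) (sq : IsPullback k g' g h) : E.IsAdmEpi g' := by
  obtain ⟨B'', g'', k', sq', h''⟩ := E.pullback_epi g h hg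
  exact isAdmEpi_of_isos h'' (sq'.isoIsPullback _ _ sq) (Iso.refl _) (by simp)

lemma IsAdmMono.of_isPushout {A B A' B' : C} {f : A ⟶ B} {h : A ⟶ A'} {k : B ⟶ B'} {f' : A' ⟶ B'}
    (hf : E.IsAdmMono f) (sq : IsPushout f h k f') : E.IsAdmMono f' := by
  obtain ⟨B'', f'', k', sq', h''⟩ := E.pushout_mono f h hf
  exact isAdmMono_of_isos h'' (Iso.refl _) (sq'.isoIsPushout _ _ sq) (by simp)

end Basic

/-! ### Admissible morphisms and direct sums. -/

section Biproducts

variable (E) in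
lemma isAdmEpi_biprod_fst (A B : C) : E.IsAdmEpi (biprod.fst : A ⊞ B ⟶ A) :=
  IsAdmEpi.of_isPullback (E.isAdmEpi_to_isZero (isZero_zero C) (0 : B ⟶ _))
    (IsPullback.of_has_biproduct A B).flip

variable (E) in
lemma isAdmMono_biprod_inl (A B : C) : E.IsAdmMono (biprod.inl : A ⟶ A ⊞ B) :=
  IsAdmMono.of_isPushout (E.isAdmMono_from_isZero (isZero_zero C) (0 : _ ⟶ B))
    (IsPushout.of_has_biproduct A B).flip

variable (E) in
lemma isAdmEpi_biprod_snd (A B : C) : E.IsAdmEpi (biprod.snd : A ⊞ B ⟶ B) :=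
  isAdmEpi_of_isos (E.isAdmEpi_biprod_fst B A) (biprod.braiding B A) (Iso.refl _) (by simp)

lemma IsAdmEpi.biprod_map_id {B Z : C} {g : B ⟶ Z} (hg : E.IsAdmEpi g) (A : C) :
    E.IsAdmEpi (biprod.map (𝟙 A) g) := by
  refine IsAdmEpi.of_isPullback (k := biprod.snd) (h := biprod.snd) hg ⟨⟨by simp⟩, ⟨?_⟩⟩
  refine PullbackCone.IsLimit.mk _ (fun s => biprod.lift (s.snd ≫ biprod.fst) s.fst)
    (fun s => by simp) (fun s => ?_) (fun s m h₁ h₂ => ?_)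
  · ext <;> simp [s.condition]
  · ext
    · simp [← h₂]
    · simpa using h₁

lemma IsAdmMono.biprod_map_id {B Z : C} {g : B ⟶ Z} (hg : E.IsAdmMono g) (A : C) :
    E.IsAdmMono (biprod.map (𝟙 A) g) := by
  refine IsAdmMono.of_isPushout (k := biprod.inr) (h := biprod.inr) hg ⟨⟨by simp⟩, ⟨?_⟩⟩
  refine PushoutCocone.IsColimit.mk _ (fun s => biprod.desc (biprod.inl ≫ s.inr) s.inl)
    (fun s => by simp) (fun s => ?_) (fun s m h₁ h₂ => ?_)
  · ext <;> simp [s.condition]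
  · ext
    · simp [← h₂]
    · simpa using h₁

/-- The automorphism of `A ⊞ B` adding `h : A ⟶ B` to the second component. -/
@[simps]
noncomputable def biprodShear {A B : C} (h : A ⟶ B) : A ⊞ B ≅ A ⊞ B where
  hom := biprod.desc (biprod.lift (𝟙 A) h) biprod.inr
  inv := biprod.desc (biprod.lift (𝟙 A) (-h)) biprod.inr
  hom_inv_id := by ext <;> simp
  inv_hom_id := by ext <;> simp

lemma IsAdmEpi.biprod_desc {A B Z : C} {g : B ⟶ Z} (hg : E.IsAdmEpi g) (h : A ⟶ Z) :
    E.IsAdmEpi (biprod.desc h g) := by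
  have : biprod.desc h g = biprod.map (𝟙 A) g ≫ (biprodShear h).hom ≫ biprod.snd := by
    ext <;> simp
  rw [this]
  exact (hg.biprod_map_id A).comp ((E.isAdmEpi_of_isIso _).comp (E.isAdmEpi_biprod_snd A Z))

lemma IsAdmMono.biprod_lift {A B Z : C} {g : A ⟶ Z} (hg : E.IsAdmMono g) (h : A ⟶ B) :
    E.IsAdmMono (biprod.lift g h) := by
  have : biprod.lift g h = biprod.inl ≫ (biprodShear h).hom ≫ biprod.map g (𝟙 B) := by
    ext <;> simp
  have e : E.IsAdmMono (biprod.map g (𝟙 B)) :=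
    isAdmMono_of_isos (hg.biprod_map_id B) (biprod.braiding _ _) (biprod.braiding _ _)
      (by ext <;> simp)
  rw [this]
  exact (E.isAdmMono_biprod_inl A B).comp ((E.isAdmMono_of_isIso _).comp e)

end Biproducts

/-! ### Cancellation in weakly idempotent-complete exact categories. -/

section Cancellation

/-- In a weakly idempotent-complete exact category, a morphism whose composition with another
one is an admissible monomorphism is an admissible monomorphism. -/
lemma IsAdmMono.of_comp (hwic : WeaklyIdempotentComplete C) {A B Z : C} {f : A ⟶ B} {g : B ⟶ Z}
    (h : E.IsAdmMono (f ≫ g)) : E.IsAdmMono f := by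
  -- The morphism with components `f ≫ g` and `f` is admissible for any `f`; a shear by `-g` clears
  -- its first component.
  have h₁ : E.IsAdmMono (biprod.lift (0 : A ⟶ Z) f) := by
    have e : biprod.lift (f ≫ g) f ≫ (biprod.braiding Z B ≪≫ biprodShear (-g) ≪≫
        biprod.braiding B Z).hom = biprod.lift (0 : A ⟶ Z) f := by
      ext <;> simp
    rw [← e]
    exact (h.biprod_lift f).comp (E.isAdmMono_of_isIso _)
  have := h₁.mono
  obtain ⟨Q, p, w, hp⟩ := h₁
  have := epi_of_conflation hp
  -- `Z` is a direct summand of the cokernel `Q` of `(0, f)`. Its complement `X` will be the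
  -- cokernel of `f`.
  obtain ⟨r, hr⟩ := exists_desc hp (biprod.fst : Z ⊞ B ⟶ Z) (by simp)
  obtain ⟨X, e, he₁, he₂⟩ := hwic (biprod.inl ≫ p) r (by simp [hr])
  have hp' : E.IsAdmEpi p := ⟨_, _, _, hp⟩
  have hfst : p ≫ e.hom ≫ biprod.fst = biprod.fst := by rw [he₂, hr]
  have hq : E.IsAdmEpi (biprod.inr ≫ p ≫ e.hom ≫ biprod.snd : B ⟶ X) := by
    refine IsAdmEpi.of_isPullback (k := biprod.inr) (h := biprod.inr)
      (hp'.comp (E.isAdmEpi_of_isIso e.hom)) ⟨⟨?_⟩, ⟨?_⟩⟩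
    · ext <;> simp [hfst]
    · refine PullbackCone.IsLimit.mk _ (fun s => s.fst ≫ biprod.snd) (fun s => ?_) (fun s => ?_)
        (fun s m h₁ h₂ => by simp [← h₁])
      · have := s.condition =≫ biprod.fst
        simp only [Category.assoc, hfst, biprod.inr_fst, comp_zero] at this
        ext <;> simp [this]
      · have h1 := s.condition =≫ biprod.fst
        have h2 := s.condition =≫ biprod.snd
        simp only [Category.assoc, hfst, biprod.inr_fst, comp_zero] at h1
        simp only [Category.assoc, biprod.inr_snd, Category.comp_id] at h2
        rw [← h2]
        have h3 : s.fst = s.fst ≫ biprod.snd ≫ biprod.inr := by ext <;> simp [h1]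
        conv_rhs => rw [h3]
        simp
  have hinr : f ≫ biprod.inr = biprod.lift (0 : A ⟶ Z) f := by ext <;> simp
  have hw : f ≫ biprod.inr ≫ p ≫ e.hom ≫ biprod.snd = 0 := by
    rw [reassoc_of% hinr, reassoc_of% w, zero_comp]
  have : Mono f := mono_of_mono_fac hinr
  refine ⟨X, _, hw, hq.conflation hw (fun T t ht => ?_)⟩
  obtain ⟨l, hl⟩ := exists_lift hp (t ≫ biprod.inr) (by
    rw [← cancel_mono e.hom]
    ext
    · simp [hfst]
    · simpa using ht)
  exact ⟨l, by simpa using hl =≫ biprod.snd⟩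

/-- In a weakly idempotent-complete exact category, a morphism whose composition with another
one is an admissible epimorphism is an admissible epimorphism. -/
lemma IsAdmEpi.of_comp (hwic : WeaklyIdempotentComplete C) {A B Z : C} {f : A ⟶ B} {g : B ⟶ Z}
    (h : E.IsAdmEpi (f ≫ g)) : E.IsAdmEpi g := by
  have h₁ : E.IsAdmEpi (biprod.desc g (0 : A ⟶ Z)) := by
    have e : (biprod.braiding B A ≪≫ biprodShear (-f) ≪≫ biprod.braiding A B).hom ≫
        biprod.desc g (f ≫ g) = biprod.desc g (0 : A ⟶ Z) := by
      ext <;> simp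
    rw [← e]
    exact (E.isAdmEpi_of_isIso _).comp (h.biprod_desc g)
  have := h₁.epi
  obtain ⟨Q, p, w, hp⟩ := h₁
  have := mono_of_conflation hp
  obtain ⟨r, hr⟩ := exists_lift hp (biprod.inr : A ⟶ B ⊞ A) (by simp)
  obtain ⟨X, e, he₁, he₂⟩ := hwic r (p ≫ biprod.snd) (by simp [reassoc_of% hr])
  have hp' : E.IsAdmMono p := ⟨_, _, _, hp⟩
  have hinl : biprod.inl ≫ e.inv ≫ p = biprod.inr := by rw [← he₁]; simp [hr]
  have hsnd : biprod.inr ≫ e.inv ≫ p ≫ biprod.snd = 0 := by rw [← he₂]; simp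
  have hq : E.IsAdmMono (biprod.inr ≫ e.inv ≫ p ≫ biprod.fst : X ⟶ B) := by
    refine IsAdmMono.of_isPushout (k := biprod.fst) (h := biprod.snd)
      ((E.isAdmMono_of_isIso e.inv).comp hp') ⟨⟨?_⟩, ⟨?_⟩⟩
    · ext
      · simp [reassoc_of% hinl]
      · simp
    · refine PushoutCocone.IsColimit.mk _ (fun s => biprod.inl ≫ s.inl) (fun s => ?_) (fun s => ?_)
        (fun s m h₁ h₂ => by simp [← h₁])
      · have := biprod.inl ≫= s.condition
        simp only [Category.assoc, reassoc_of% hinl, biprod.inl_snd_assoc, zero_comp] at this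
        ext <;> simp [this]
      · have h1 := biprod.inl ≫= s.condition
        have h2 := biprod.inr ≫= s.condition
        simp only [Category.assoc, reassoc_of% hinl, biprod.inl_snd_assoc, zero_comp] at h1
        simp only [Category.assoc, biprod.inr_snd_assoc] at h2
        rw [← h2]
        have h3 : s.inl = biprod.fst ≫ biprod.inl ≫ s.inl := by ext <;> simp [h1]
        conv_rhs => rw [h3]
        simp
  have hw : (biprod.inr ≫ e.inv ≫ p ≫ biprod.fst : X ⟶ B) ≫ g = 0 := by
    have : biprod.fst ≫ g = biprod.desc g (0 : A ⟶ Z) := by ext <;> simp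
    simp only [Category.assoc, this, w, comp_zero]
  have : Epi g := epi_of_epi_fac (h := biprod.desc g (0 : A ⟶ Z)) (f := biprod.fst)
    (by ext <;> simp)
  refine ⟨X, _, hw, hq.conflation hw (fun T t ht => ?_)⟩
  obtain ⟨l, hl⟩ := exists_desc hp (biprod.fst ≫ t) (by
    rw [← cancel_epi e.inv]
    ext
    · simp [reassoc_of% hinl]
    · simpa using ht)
  exact ⟨l, by simpa using biprod.inl ≫= hl⟩

end Cancellation

/-! ### Pullback and pushout squares with admissible morphisms. -/

section Squares

/-- Pullbacks of admissible monomorphisms along admissible epimorphisms exist and are admissible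
monomorphisms. -/
lemma exists_isPullback {B Z N : C} {g : B ⟶ Z} (hg : E.IsAdmEpi g) {n : N ⟶ Z}
    (hn : E.IsAdmMono n) : ∃ (P : C) (k : P ⟶ B) (q : P ⟶ N), IsPullback k q g n ∧
      E.IsAdmMono k ∧ E.IsAdmEpi q := by
  obtain ⟨P, q, k, sq, hq⟩ := E.pullback_epi g n hg
  refine ⟨P, k, q, sq, ?_, hq⟩
  have := hn.mono
  obtain ⟨W, r, w, hr⟩ := hn
  have hk : Mono k := ⟨fun a b hab => sq.hom_ext hab (by
    rw [← cancel_mono n, Category.assoc, Category.assoc, ← sq.w, reassoc_of% hab])⟩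
  -- The pullback is the kernel of the composite `B ⟶ Z ⟶ W`, which is an admissible epimorphism.
  refine ⟨W, g ≫ r, by rw [reassoc_of% sq.w, w, comp_zero],
    (hg.comp ⟨_, _, _, hr⟩).conflation _ (fun T t ht => ?_)⟩
  obtain ⟨l, hl⟩ := exists_lift hr (t ≫ g) (by simpa using ht)
  exact ⟨sq.lift t l hl.symm, by simp⟩

/-- The pushout of a short exact sequence. -/
lemma exists_pushout_conflation {A B Z A' : C} {f : A ⟶ B} {g : B ⟶ Z} {w : f ≫ g = 0}
    (h : E.conflation (ShortComplex.mk f g w)) (a : A ⟶ A') :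
    ∃ (P : C) (u : B ⟶ P) (v : A' ⟶ P) (q : P ⟶ Z) (wq : v ≫ q = 0), IsPushout f a u v ∧
      u ≫ q = g ∧ E.conflation (ShortComplex.mk v q wq) := by
  obtain ⟨P, v, u, sq, hv⟩ := E.pushout_mono f a ⟨_, _, _, h⟩
  have hg := epi_of_conflation h
  refine ⟨P, u, v, sq.desc g 0 (by simp [w]), by simp, sq, by simp, ?_⟩
  have : Epi (sq.desc g (0 : A' ⟶ Z) (by simp [w])) :=
    epi_of_epi_fac (h := g) (f := u) (by simp)
  refine IsAdmMono.conflation hv _ (fun T t ht => ?_)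
  obtain ⟨l, hl⟩ := exists_desc h (u ≫ t) (by rw [sq.w_assoc, ht, comp_zero])
  exact ⟨l, sq.hom_ext (by simp [hl]) (by simp [ht])⟩

/-- The short exact sequence `A ⟶ B ⊞ A' ⟶ P` of a pushout square. -/
lemma conflation_of_isPushout {A B A' P : C} {f : A ⟶ B} (hf : E.IsAdmMono f) {a : A ⟶ A'}
    {u : B ⟶ P} {v : A' ⟶ P} (sq : IsPushout f a u v) :
    E.conflation (ShortComplex.mk (biprod.lift (-f) a) (biprod.desc u v) (by simp [sq.w])) := by
  have h₁ : E.IsAdmMono (biprod.lift (-f) a) :=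
    IsAdmMono.biprod_lift (isAdmMono_of_isos hf (Iso.refl A)
      (⟨-𝟙 B, -𝟙 B, by simp, by simp⟩ : B ≅ B) (by simp)) a
  have : Epi (biprod.desc u v) := ⟨fun s t hst => sq.hom_ext
    (by simpa using biprod.inl ≫= hst) (by simpa using biprod.inr ≫= hst)⟩
  refine h₁.conflation _ (fun T t ht => ?_)
  have e : biprod.lift (-f) a = -f ≫ biprod.inl + a ≫ biprod.inr := by ext <;> simp
  rw [e] at ht
  simp only [Preadditive.add_comp, Preadditive.neg_comp, Category.assoc] at ht
  exact ⟨sq.desc (biprod.inl ≫ t) (biprod.inr ≫ t) (neg_add_eq_zero.mp ht), by ext <;> simp⟩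

/-- The uniqueness half of the pullback property: `c` factors through `A`, where `t` restricts to
the monomorphism `i`. -/
lemma eq_zero_of_morphism {A P Z B W : C} {v : A ⟶ P} {q : P ⟶ Z} {wv : v ≫ q = 0}
    (h : E.conflation (ShortComplex.mk v q wv)) {i : A ⟶ B} {p : B ⟶ W} {wi : i ≫ p = 0}
    (h' : E.conflation (ShortComplex.mk i p wi)) {t : P ⟶ B} (hv : v ≫ t = i) {T : C}
    (c : T ⟶ P) (h₁ : c ≫ t = 0) (h₂ : c ≫ q = 0) : c = 0 := by
  have him := mono_of_conflation h'
  obtain ⟨b, rfl⟩ := exists_lift h c h₂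
  rw [Category.assoc, hv, ← zero_comp (f := i), cancel_mono] at h₁
  rw [h₁, zero_comp]

/-- A morphism of short exact sequences that is the identity on the first terms has the
universal property of a pullback at its right square. -/
lemma exists_lift_of_morphism {A P Z B W : C} {v : A ⟶ P} {q : P ⟶ Z} {wv : v ≫ q = 0}
    (h : E.conflation (ShortComplex.mk v q wv)) {i : A ⟶ B} {p : B ⟶ W} {wi : i ≫ p = 0}
    (h' : E.conflation (ShortComplex.mk i p wi)) {t : P ⟶ B} {z : Z ⟶ W} (hv : v ≫ t = i)
    (hq : t ≫ p = q ≫ z) {T : C} (x : T ⟶ B) (a : T ⟶ Z) (hxa : x ≫ p = a ≫ z) :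
    ∃ c : T ⟶ P, c ≫ t = x ∧ c ≫ q = a := by
  -- A lift exists after pulling `q` back to `T'`. It misses `x` by a morphism into `A`; subtracting
  -- this error leaves a lift that vanishes on the kernel of `e` and therefore descends to `T`.
  obtain ⟨T', e, c', sq, he⟩ := E.pullback_epi q a ⟨_, _, _, h⟩
  obtain ⟨b, hb⟩ := exists_lift h' (c' ≫ t - e ≫ x) (by
    rw [Preadditive.sub_comp, Category.assoc, Category.assoc, hq, hxa, sq.w_assoc, sub_self])
  obtain ⟨T'', j, wj, hj⟩ := he
  have := epi_of_conflation hj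
  have hx : (c' - b ≫ v) ≫ t = e ≫ x := by
    rw [Preadditive.sub_comp, Category.assoc, hv, hb, sub_sub_cancel]
  have ha : (c' - b ≫ v) ≫ q = e ≫ a := by
    rw [Preadditive.sub_comp, Category.assoc, wv, comp_zero, sub_zero, sq.w]
  obtain ⟨c, hc⟩ := exists_desc hj (c' - b ≫ v) (eq_zero_of_morphism h h' hv _
    (by rw [Category.assoc, hx, reassoc_of% wj, zero_comp])
    (by rw [Category.assoc, ha, reassoc_of% wj, zero_comp]))
  exact ⟨c, by rw [← cancel_epi e, reassoc_of% hc, hx],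
    by rw [← cancel_epi e, reassoc_of% hc, ha]⟩

end Squares

end ExactStructure

/-! ### Regular bounds and transfinite recursion. -/

section Cardinals

/-- By well-ordering the infimum is attained once a regular bound exists, and for a small set the
successor of an infinite bound is regular. Without smallness the infimum could be that of the empty
set, with junk value `0`. -/
lemma leastRegularBound_spec (s : Set Cardinal.{v}) [Small.{v} s] :
    IsRegularOrZero (leastRegularBound s) ∧ ∀ a ∈ s, a ≤ leastRegularBound s := by
  have h : {c | IsRegularOrZero c ∧ ∀ a ∈ s, a ≤ c}.Nonempty := by
    obtain ⟨b, hb⟩ := Cardinal.bddAbove_of_small (s := s)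
    exact ⟨Order.succ (max Cardinal.aleph0 b), Or.inr (Cardinal.isRegular_succ (le_max_left _ _)),
      fun a ha => (hb ha).trans ((le_max_right _ _).trans (Order.le_succ _))⟩
  exact csInf_mem h

lemma exists_isRegular_gt {I : Type v} (κ : Cardinal.{v}) (c : I → Cardinal.{v}) :
    ∃ lam : Cardinal.{v}, lam.IsRegular ∧ κ < lam ∧ ∀ i, c i ≤ lam := by
  obtain ⟨b, hb⟩ := Cardinal.bddAbove_of_small (s := Set.range c)
  refine ⟨Order.succ (max Cardinal.aleph0 (max κ b)), Cardinal.isRegular_succ (le_max_left _ _),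
    Order.lt_succ_of_le ((le_max_left _ _).trans (le_max_right _ _)), fun i => ?_⟩
  exact (hb ⟨i, rfl⟩).trans (((le_max_right _ _).trans (le_max_right _ _)).trans (Order.le_succ _))

/-- Transfinite recursion along a regular cardinal: if every family of fewer than `κ` elements has
an upper bound for the relation `R`, there is an `R`-increasing sequence of length `κ`. -/
lemma exists_increasing_sequence {S : Type*} (R : S → S → Prop) {κ : Cardinal.{v}}
    (h : ∀ (I : Type v), Cardinal.mk I < κ → ∀ s : I → S, ∃ t, ∀ i, R (s i) t) :
    ∃ F : Set.Iio κ.ord → S, ∀ i j, i < j → R (F i) (F j) := by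
  have hcard : ∀ j : κ.ord.ToType, Cardinal.mk (Set.Iio j) < κ := fun j =>
    (Cardinal.mk_Iio_lt j (by simp)).trans_eq (by simp)
  -- The recursion runs over `κ.ord.ToType`, whose initial segments lie in `Type v` as `h` demands;
  -- those of `Set.Iio κ.ord` lie one universe higher.
  let G : κ.ord.ToType → S := WellFounded.fix (C := fun _ => S) wellFounded_lt
    (fun j s => (h (Set.Iio j) (hcard j) (fun i => s i.1 i.2)).choose)
  have hG : ∀ i j, i < j → R (G i) (G j) := by
    intro i j hij
    have e : G j = (h (Set.Iio j) (hcard j) (fun i => G i.1)).choose := by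
      simp only [G]
      rw [WellFounded.fix_eq]
    rw [e]
    exact (h (Set.Iio j) (hcard j) (fun i => G i.1)).choose_spec ⟨i, hij⟩
  exact ⟨fun i => G (Ordinal.ToType.mk i), fun i j hij =>
    hG _ _ (Ordinal.ToType.mk.lt_iff_lt.mpr hij)⟩

end Cardinals

/-! ### The cardinals `φ^β(λ)` and `φ_κ(λ)`, and the objects below them. -/

namespace ExactStructure

variable {C : Type u} [Category.{v} C] [Preadditive C] [HasZeroObject C] [HasBinaryBiproducts C]
  {E : ExactStructure C} {ψ : C → Cardinal.{v}}

lemma nonempty_iso_of_conflation {A A' B Z : C} {f : A ⟶ B} {f' : A' ⟶ B} {g : B ⟶ Z}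
    {w : f ≫ g = 0} {w' : f' ≫ g = 0} (h : E.conflation (ShortComplex.mk f g w))
    (h' : E.conflation (ShortComplex.mk f' g w')) : Nonempty (A ≅ A') := by
  obtain ⟨hl⟩ := E.isKernel _ h
  obtain ⟨hl'⟩ := E.isKernel _ h'
  exact ⟨IsLimit.conePointUniqueUpToIso hl hl'⟩

namespace IsSizeFunction

variable (hψ : E.IsSizeFunction ψ)

include hψ

/-- A kernel is determined up to isomorphism by its admissible epimorphism, and the morphisms
between representatives of the objects of `E_lam` form a set. -/
lemma small_kernels {lam : Cardinal.{v}} (hlam : IsRegularOrZero lam) :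
    Small.{v} {a | ∃ S, E.conflation S ∧ ψ S.X₂ ≤ lam ∧ ψ S.X₃ ≤ lam ∧ a = ψ S.X₁} := by
  classical
  obtain ⟨Q, hQ, hle⟩ := (hψ.small lam hlam).exists_small_le'
  -- The value `0` on other morphisms is harmless: only an inclusion in the range of `val` is
  -- needed.
  let val : (Σ (B Z : Subtype Q), (B.1 ⟶ Z.1)) → Cardinal.{v} := fun x =>
    if h : E.IsAdmEpi x.2.2 then ψ h.choose else 0
  refine small_subset (s := Set.range val) ?_
  rintro _ ⟨⟨f, g, w⟩, hS, h₂, h₃, rfl⟩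
  rename_i A B Z
  obtain ⟨B', hB', ⟨b⟩⟩ := hle B h₂
  obtain ⟨Z', hZ', ⟨z⟩⟩ := hle Z h₃
  have w' : (f ≫ b.hom) ≫ b.inv ≫ g ≫ z.hom = 0 := by simp [reassoc_of% w]
  have hc : E.conflation (ShortComplex.mk (f ≫ b.hom) (b.inv ≫ g ≫ z.hom) w') :=
    conflation_of_isos hS w' (Iso.refl _) b z (by simp) (by simp)
  have he : E.IsAdmEpi (b.inv ≫ g ≫ z.hom) := ⟨_, _, _, hc⟩
  refine ⟨⟨⟨B', hB'⟩, ⟨Z', hZ'⟩, b.inv ≫ g ≫ z.hom⟩, ?_⟩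
  simp only [val]
  rw [dif_pos he]
  obtain ⟨i, w'', hc'⟩ := he.choose_spec
  exact hψ.iso _ _ (nonempty_iso_of_conflation hc' hc)

lemma phi_spec {lam : Cardinal.{v}} (hlam : IsRegularOrZero lam) :
    IsRegularOrZero (E.phi ψ lam) ∧
      ∀ S, E.conflation S → ψ S.X₂ ≤ lam → ψ S.X₃ ≤ lam → ψ S.X₁ ≤ E.phi ψ lam := by
  have := hψ.small_kernels hlam
  obtain ⟨h₁, h₂⟩ := leastRegularBound_spec
    {a | ∃ S, E.conflation S ∧ ψ S.X₂ ≤ lam ∧ ψ S.X₃ ≤ lam ∧ a = ψ S.X₁}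
  exact ⟨h₁, fun S hS hS₂ hS₃ => h₂ _ ⟨S, hS, hS₂, hS₃, rfl⟩⟩

/-- `X` is the kernel of `X ⟶ 0`. The inequality `lam ≤ φ(lam)` of cardinals can fail, for instance
when all objects are zero, so monotonicity is stated through objects. -/
lemma le_phi {lam : Cardinal.{v}} (hlam : IsRegularOrZero lam) {X : C} (hX : ψ X ≤ lam) :
    ψ X ≤ E.phi ψ lam := by
  have h' : E.conflation (ShortComplex.mk (𝟙 X) (0 : X ⟶ _) comp_zero) :=
    (E.isAdmEpi_to_isZero (isZero_zero C) (0 : X ⟶ _)).conflation _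
      (fun T t _ => ⟨t, Category.comp_id t⟩)
  exact (hψ.phi_spec hlam).2 _ h' hX (by
    rw [hψ.zero _ (isZero_zero C)]
    exact zero_le)

end IsSizeFunction

variable (E ψ) in
lemma phiUpper_zero (lam : Cardinal.{v}) : E.phiUpper ψ lam 0 = lam :=
  Ordinal.limitRecOn_zero ..

variable (E ψ) in
lemma phiUpper_add_one (lam : Cardinal.{v}) (β : Ordinal.{v}) :
    E.phiUpper ψ lam (β + 1) = E.phi ψ (E.phiUpper ψ lam β) :=
  Ordinal.limitRecOn_add_one ..

variable (E ψ) in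
lemma phiUpper_limit (lam : Cardinal.{v}) {α : Ordinal.{v}} (hα : Order.IsSuccLimit α) :
    E.phiUpper ψ lam α = E.phi ψ (leastRegularBound {a | ∃ β < α, a = E.phiUpper ψ lam β}) := by
  rw [phiUpper, Ordinal.limitRecOn_limit _ _ _ _ hα]
  simp only [exists_prop]
  rfl

variable (E ψ) in
lemma phiLower_limit (lam : Cardinal.{v}) {α : Ordinal.{v}} (hα : Order.IsSuccLimit α) :
    E.phiLower ψ lam α = leastRegularBound {a | ∃ β < α, a = E.phiUpper ψ lam β} :=
  Ordinal.limitRecOn_limit _ _ _ _ hα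

lemma small_phiUpper (lam : Cardinal.{v}) (α : Ordinal.{v}) :
    Small.{v} {a | ∃ β < α, a = E.phiUpper ψ lam β} := by
  have : {a | ∃ β < α, a = E.phiUpper ψ lam β} = E.phiUpper ψ lam '' Set.Iio α := by
    ext a
    simp [eq_comm]
  rw [this]
  infer_instance

namespace IsSizeFunction

variable (hψ : E.IsSizeFunction ψ) {lam : Cardinal.{v}} (hlam : lam.IsRegular)

include hψ hlam

lemma isRegularOrZero_phiUpper (β : Ordinal.{v}) : IsRegularOrZero (E.phiUpper ψ lam β) := by
  induction β using Ordinal.limitRecOn with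
  | zero => rw [phiUpper_zero]; exact Or.inr hlam
  | add_one β ih => rw [phiUpper_add_one]; exact (hψ.phi_spec ih).1
  | limit α hα ih =>
    rw [phiUpper_limit _ _ _ hα]
    have := small_phiUpper (E := E) (ψ := ψ) lam α
    exact (hψ.phi_spec (leastRegularBound_spec _).1).1

lemma le_phiUpper {X : C} {β γ : Ordinal.{v}} (hβγ : β ≤ γ) (hX : ψ X ≤ E.phiUpper ψ lam β) :
    ψ X ≤ E.phiUpper ψ lam γ := by
  induction γ using Ordinal.limitRecOn with
  | zero => rwa [le_antisymm hβγ (zero_le)] at hX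
  | add_one γ ih =>
    obtain rfl | h := hβγ.eq_or_lt
    · exact hX
    · rw [phiUpper_add_one]
      exact hψ.le_phi (hψ.isRegularOrZero_phiUpper hlam γ) (ih (Order.lt_add_one_iff.mp h))
  | limit α hα ih =>
    obtain rfl | h := hβγ.eq_or_lt
    · exact hX
    · rw [phiUpper_limit _ _ _ hα]
      have := small_phiUpper (E := E) (ψ := ψ) lam α
      obtain ⟨h₁, h₂⟩ := leastRegularBound_spec {a | ∃ β < α, a = E.phiUpper ψ lam β}
      exact hψ.le_phi h₁ (hX.trans (h₂ _ ⟨β, h, rfl⟩))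

end IsSizeFunction

variable (E ψ) in
/-- The union of the classes of objects of size at most `φ^β(lam)`, for `β < κ`. -/
def IsBelow (lam κ : Cardinal.{v}) (X : C) : Prop :=
  ∃ β < κ.ord, ψ X ≤ E.phiUpper ψ lam β

lemma phiLower_isRegular {lam κ : Cardinal.{v}} (hlam : lam.IsRegular)
    (hκ : κ.IsRegular) :
    (E.phiLower ψ lam κ.ord).IsRegular ∧ lam ≤ E.phiLower ψ lam κ.ord := by
  rw [phiLower_limit _ _ _ (Cardinal.isSuccLimit_ord hκ.aleph0_le)]
  have := small_phiUpper (E := E) (ψ := ψ) lam κ.ord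
  obtain ⟨h₁, h₂⟩ := leastRegularBound_spec {a | ∃ β < κ.ord, a = E.phiUpper ψ lam β}
  have h₃ := h₂ lam ⟨0, hκ.ord_pos, (phiUpper_zero _ _ _).symm⟩
  refine ⟨h₁.resolve_left fun h => ?_, h₃⟩
  rw [h] at h₃
  exact hlam.ne_zero (le_antisymm h₃ zero_le)

namespace IsBelow

variable {lam κ : Cardinal.{v}}

lemma le_phiLower (hκ : κ.IsRegular) {X : C} (hX : E.IsBelow ψ lam κ X) :
    ψ X ≤ E.phiLower ψ lam κ.ord := by
  obtain ⟨β, hβ, h⟩ := hX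
  rw [phiLower_limit _ _ _ (Cardinal.isSuccLimit_ord hκ.aleph0_le)]
  have := small_phiUpper (E := E) (ψ := ψ) lam κ.ord
  exact h.trans ((leastRegularBound_spec {a | ∃ β < κ.ord, a = E.phiUpper ψ lam β}).2 _
    ⟨β, hβ, rfl⟩)

lemma of_le (hκ : κ.IsRegular) {X : C} (hX : ψ X ≤ lam) : E.IsBelow ψ lam κ X :=
  ⟨0, hκ.ord_pos, by rwa [phiUpper_zero]⟩

variable (hψ : E.IsSizeFunction ψ) (hlam : lam.IsRegular) (hκ : κ.IsRegular)

include hψ hlam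

lemma cover {B Z : C} {g : B ⟶ Z} (hg : E.IsAdmEpi g) (hZ : E.IsBelow ψ lam κ Z) :
    ∃ (D : C) (d : D ⟶ B), E.IsAdmMono d ∧ E.IsBelow ψ lam κ D ∧ E.IsAdmEpi (d ≫ g) := by
  obtain ⟨β, hβ, h⟩ := hZ
  obtain ⟨D, d, hd, hD, hdg⟩ := hψ.cover _ (hψ.isRegularOrZero_phiUpper hlam β) B Z g hg h
  exact ⟨D, d, hd, ⟨β, hβ, hD⟩, hdg⟩

include hκ

/-- By regularity of `κ`, fewer than `κ` ordinals below `κ.ord` have their supremum below `κ.ord`.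
-/
lemma exists_bound {I : Type v} (hI : Cardinal.mk I < κ) {A : I → C}
    (hA : ∀ i, E.IsBelow ψ lam κ (A i)) :
    ∃ β < κ.ord, ∀ i, ψ (A i) ≤ E.phiUpper ψ lam β := by
  choose β hβ hAβ using hA
  refine ⟨⨆ i, β i, Ordinal.iSup_lt_of_lt_cof (by rwa [hκ.cof_ord]) hβ, fun i => ?_⟩
  exact hψ.le_phiUpper hlam (Ordinal.le_iSup β i) (hAβ i)

/-- Factoring fewer than `κ` morphisms requires a level above `κ`, but `φ^β(lam)` may be smaller
than `lam`. The larger of the two serves, and its objects are still below `φ_κ(lam)`. -/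
lemma exists_max {β : Ordinal.{v}} (hβ : β < κ.ord) :
    ∃ c : Cardinal.{v}, IsRegularOrZero c ∧ lam ≤ c ∧ E.phiUpper ψ lam β ≤ c ∧
      ∀ X : C, ψ X ≤ c → E.IsBelow ψ lam κ X := by
  obtain h | h := le_total lam (E.phiUpper ψ lam β)
  · exact ⟨_, hψ.isRegularOrZero_phiUpper hlam β, h, le_rfl, fun X hX => ⟨β, hβ, hX⟩⟩
  · exact ⟨lam, Or.inr hlam, le_rfl, h, fun X hX => of_le hκ hX⟩

/-- Fewer than `κ` morphisms from objects below `φ_κ(lam)` factor through a common admissible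
subobject of the same kind. -/
lemma factor (hκlam : κ < lam) {B : C} {I : Type v} (hI : Cardinal.mk I < κ) (F : I → Over B)
    (hF : ∀ i, E.IsBelow ψ lam κ (F i).left) :
    ∃ (D : C) (d : D ⟶ B), E.IsAdmMono d ∧ E.IsBelow ψ lam κ D ∧
      ∀ i, ∃ g : (F i).left ⟶ D, g ≫ d = (F i).hom := by
  obtain ⟨β, hβ, h⟩ := exists_bound hψ hlam hκ hI hF
  obtain ⟨c, hc, hlamc, hβc, hcX⟩ := exists_max hψ hlam hκ hβ
  obtain ⟨D, d, hd, hD, hg⟩ := hψ.factor c hc B I (hI.trans (hκlam.trans_le hlamc)) _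
    (fun i => (F i).hom) (fun i => (h i).trans hβc)
  exact ⟨D, d, hd, hcX D hD, hg⟩

/-- A kernel costs one application of `φ`, which the limit ordinal `κ.ord` leaves room for. No fixed
level `φ^β(lam)` need be closed under kernels. -/
lemma kernel {S : ShortComplex C} (hS : E.conflation S) (h₂ : E.IsBelow ψ lam κ S.X₂)
    (h₃ : E.IsBelow ψ lam κ S.X₃) : E.IsBelow ψ lam κ S.X₁ := by
  obtain ⟨β, hβ, h₂⟩ := h₂
  obtain ⟨γ, hγ, h₃⟩ := h₃
  have hlim := Cardinal.isSuccLimit_ord hκ.aleph0_le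
  refine ⟨max β γ + 1, hlim.add_one_lt (max_lt hβ hγ), ?_⟩
  rw [phiUpper_add_one]
  exact (hψ.phi_spec (hψ.isRegularOrZero_phiUpper hlam _)).2 S hS
    (hψ.le_phiUpper hlam (le_max_left _ _) h₂) (hψ.le_phiUpper hlam (le_max_right _ _) h₃)

end IsBelow

end ExactStructure

/-! ### Colimits of increasing families of subobjects. -/

section Chains

variable {C : Type u} [Category.{v} C] {J : Type*}

/-- The functor attached to an increasing family of subobjects of `Z`. -/
noncomputable abbrev subChain [Preorder J] {Z : C} (X : J → C) (x : ∀ i, X i ⟶ Z)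
    [∀ i, Mono (x i)] (h : ∀ i j, i ≤ j → ∃ f : X i ⟶ X j, f ≫ x j = x i) : J ⥤ C where
  obj := X
  map φ := (h _ _ (leOfHom φ)).choose
  map_id i := by
    rw [← cancel_mono (x i), (h i i le_rfl).choose_spec, Category.id_comp]
  map_comp {i j k} φ φ' := by
    rw [← cancel_mono (x k), Category.assoc, (h _ _ (leOfHom φ')).choose_spec,
      (h _ _ (leOfHom φ)).choose_spec, (h _ _ (leOfHom (φ ≫ φ'))).choose_spec]

/-- The morphisms `c` exhibit `P` as the colimit of an increasing family of subobjects of `Z`. -/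
structure IsChainColimit {Z : C} (X : J → C) (x : ∀ i, X i ⟶ Z) {P : C} (c : ∀ i, X i ⟶ P) :
    Prop where
  w : ∀ {i j} (f : X i ⟶ X j), f ≫ x j = x i → f ≫ c j = c i
  desc : ∀ {T : C} (t : ∀ i, X i ⟶ T), (∀ i j (f : X i ⟶ X j), f ≫ x j = x i → f ≫ t j = t i) →
    ∃ l : P ⟶ T, ∀ i, c i ≫ l = t i
  hom_ext : ∀ {T : C} (a b : P ⟶ T), (∀ i, c i ≫ a = c i ≫ b) → a = b

namespace IsChainColimit

variable {Z : C} {X : J → C} {x : ∀ i, X i ⟶ Z} {P : C} {c : ∀ i, X i ⟶ P}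

/-- `f` may also point backwards, from a larger index to a smaller one. Since the `x i` are
monomorphisms, the transition morphism then undoes `f`. -/
lemma cocone_w [LinearOrder J] [∀ i, Mono (x i)]
    (h : ∀ i j, i ≤ j → ∃ f : X i ⟶ X j, f ≫ x j = x i) (c : Cocone (subChain X x h)) {i j : J}
    (f : X i ⟶ X j) (hf : f ≫ x j = x i) : f ≫ c.ι.app j = c.ι.app i := by
  obtain hij | hij := le_total i j
  · have e : (subChain X x h).map (homOfLE hij) = f := by
      rw [← cancel_mono (x j), hf]
      exact (h i j hij).choose_spec
    rw [← e]
    exact c.w (homOfLE hij)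
  · have e : f ≫ (subChain X x h).map (homOfLE hij) = 𝟙 (X i) := by
      rw [← cancel_mono (x i), Category.id_comp, Category.assoc]
      exact (congrArg (f ≫ ·) (h j i hij).choose_spec).trans hf
    have e' := c.w (homOfLE hij)
    rw [← e', ← Category.assoc, e]
    exact Category.id_comp _

lemma of_isColimit [LinearOrder J] [∀ i, Mono (x i)]
    (h : ∀ i j, i ≤ j → ∃ f : X i ⟶ X j, f ≫ x j = x i)
    (c : Cocone (subChain X x h)) (hc : IsColimit c) :
    IsChainColimit X x (P := c.pt) (fun i => c.ι.app i) where
  w f hf := cocone_w h c f hf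
  desc {T} t ht :=
    ⟨hc.desc ⟨T, ⟨t, fun i j φ => (ht _ _ _ (h i j (leOfHom φ)).choose_spec).trans
      (Category.comp_id _).symm⟩⟩, fun i => hc.fac _ i⟩
  hom_ext _ _ hab := hc.hom_ext hab

/-- The cocone with components `c`. -/
abbrev cocone [Preorder J] [∀ i, Mono (x i)] (hc : IsChainColimit X x c)
    (h : ∀ i j, i ≤ j → ∃ f : X i ⟶ X j, f ≫ x j = x i) : Cocone (subChain X x h) :=
  ⟨P, ⟨c, fun i j φ => (hc.w _ (h i j (leOfHom φ)).choose_spec).trans (Category.comp_id _).symm⟩⟩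

lemma nonempty_isColimit [LinearOrder J] [∀ i, Mono (x i)] (hc : IsChainColimit X x c)
    (h : ∀ i j, i ≤ j → ∃ f : X i ⟶ X j, f ≫ x j = x i) : Nonempty (IsColimit (hc.cocone h)) := by
  choose l hl using fun s : Cocone (subChain X x h) =>
    hc.desc (T := s.pt) (fun i => s.ι.app i) (fun i j f hf => cocone_w h s f hf)
  exact ⟨⟨l, hl, fun s m hm => hc.hom_ext _ _ fun i => (hm i).trans (hl s i).symm⟩⟩

/-- Both morphisms can be compared at the index `max j j'`, where they agree because `x` is a
monomorphism. -/
lemma comp_eq_of_compatible [LinearOrder J] [∀ i, Mono (x i)]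
    (h : ∀ i j, i ≤ j → ∃ f : X i ⟶ X j, f ≫ x j = x i) {T : C} (t : ∀ i, X i ⟶ T)
    (ht : ∀ i j (f : X i ⟶ X j), f ≫ x j = x i → f ≫ t j = t i) {V : C} {j j' : J}
    (f : V ⟶ X j) (f' : V ⟶ X j') (hff : f ≫ x j = f' ≫ x j') : f ≫ t j = f' ≫ t j' := by
  obtain ⟨a, ha⟩ := h _ _ (le_max_left j j')
  obtain ⟨b, hb⟩ := h _ _ (le_max_right j j')
  rw [← ht _ _ a ha, ← ht _ _ b hb, ← Category.assoc, ← Category.assoc]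
  congr 1
  rw [← cancel_mono (x (max j j')), Category.assoc, Category.assoc, ha, hb, hff]

lemma comp_eq_of_comp_eq [LinearOrder J] [∀ i, Mono (x i)] (hc : IsChainColimit X x c)
    (h : ∀ i j, i ≤ j → ∃ f : X i ⟶ X j, f ≫ x j = x i) {V : C} {j j' : J}
    (f : V ⟶ X j) (f' : V ⟶ X j') (hff : f ≫ x j = f' ≫ x j') : f ≫ c j = f' ≫ c j' :=
  comp_eq_of_compatible h c (fun _ _ f hf => hc.w f hf) f f' hff

/-- Two increasing families of subobjects that are cofinal in each other have the same colimit. -/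
lemma interleave [LinearOrder J] [∀ i, Mono (x i)] (hc : IsChainColimit X x c)
    (hX : ∀ i j, i ≤ j → ∃ f : X i ⟶ X j, f ≫ x j = x i)
    {Y : J → C} {y : ∀ i, Y i ⟶ Z} [∀ i, Mono (y i)]
    (hY : ∀ i j, i ≤ j → ∃ f : Y i ⟶ Y j, f ≫ y j = y i)
    (hXY : ∀ i, ∃ j, ∃ f : X i ⟶ Y j, f ≫ y j = x i)
    (hYX : ∀ i, ∃ j, ∃ f : Y i ⟶ X j, f ≫ x j = y i) :
    ∃ d : ∀ i, Y i ⟶ P, IsChainColimit Y y d ∧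
      (∀ i j (f : Y i ⟶ X j), f ≫ x j = y i → f ≫ c j = d i) ∧
      ∀ i j (f : X i ⟶ Y j), f ≫ y j = x i → f ≫ d j = c i := by
  have keyX := fun {V} {j j'} (f : V ⟶ X j) (f' : V ⟶ X j') =>
    hc.comp_eq_of_comp_eq hX f f'
  choose s f hf using hYX
  choose r g hg using hXY
  -- By `keyX` the component `d i` depends neither on the index `s i` nor on the chosen `f i`.
  refine ⟨fun i => f i ≫ c (s i), ⟨fun {i j} u hu => ?_, fun {T} t ht => ?_, fun a b hab => ?_⟩,
    fun i j u hu => keyX _ _ (by rw [hu, hf]), fun i j u hu => ?_⟩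
  · rw [← Category.assoc]
    exact keyX _ _ (by rw [Category.assoc, hf, hf, hu])
  · obtain ⟨l, hl⟩ := hc.desc (fun i => g i ≫ t (r i)) (fun i j u hu => by
      rw [← Category.assoc]
      exact comp_eq_of_compatible hY t ht _ _ (by rw [Category.assoc, hg, hg, hu]))
    refine ⟨l, fun i => ?_⟩
    rw [Category.assoc, hl, ← Category.assoc]
    simpa using comp_eq_of_compatible hY t ht (f i ≫ g (s i)) (𝟙 (Y i))
      (by rw [Category.assoc, hg, hf, Category.id_comp])
  · refine hc.hom_ext _ _ fun i => ?_
    have e : g i ≫ f (r i) ≫ c (s (r i)) = c i := by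
      simpa using keyX (g i ≫ f (r i)) (𝟙 (X i))
        (by rw [Category.assoc, hf, hg, Category.id_comp])
    simpa [e, reassoc_of% e] using (g i) ≫= hab (r i)
  · simpa using keyX (u ≫ f j) (𝟙 (X i)) (by rw [Category.assoc, hf, hu, Category.id_comp])

end IsChainColimit

end Chains

/-! ### The chain conditions applied to families of admissible subobjects. -/

namespace ExactStructure

variable {C : Type u} [Category.{v} C] [Preadditive C] [HasZeroObject C] [HasBinaryBiproducts C]
  {E : ExactStructure C} {κ : Cardinal.{v}} {α : Ordinal.{v}}

section

variable {Z : C} {X : Set.Iio α → C} {x : ∀ i, X i ⟶ Z} [∀ i, Mono (x i)]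

/-- A transition morphism followed by `x j` is the admissible `x i`, so cancellation applies. -/
lemma isChain_subChain (hwic : WeaklyIdempotentComplete C) (hx : ∀ i, E.IsAdmMono (x i))
    (h : ∀ i j, i ≤ j → ∃ f : X i ⟶ X j, f ≫ x j = x i) : E.IsChain (subChain X x h) := by
  intro i j hij
  have e : (subChain X x h).map (homOfLE hij.le) ≫ x j = x i := (h i j hij.le).choose_spec
  refine IsAdmMono.of_comp hwic (g := x j) ?_
  rw [e]
  exact hx i

/-- The tautological cocone on an increasing family of subobjects of `Z`. -/
abbrev subChainCocone (h : ∀ i j, i ≤ j → ∃ f : X i ⟶ X j, f ≫ x j = x i) :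
    Cocone (subChain X x h) :=
  ⟨Z, ⟨x, fun i j φ => (h i j (leOfHom φ)).choose_spec.trans (Category.comp_id _).symm⟩⟩

lemma HasExactChainColimits.exists_isChainColimit (hE : E.HasExactChainColimits κ)
    (hwic : WeaklyIdempotentComplete C) (hα : κ ≤ α.cof) (hx : ∀ i, E.IsAdmMono (x i))
    (h : ∀ i j, i ≤ j → ∃ f : X i ⟶ X j, f ≫ x j = x i) :
    ∃ (P : C) (c : ∀ i, X i ⟶ P), IsChainColimit X x c := by
  have := hE.hasColimit α hα (subChain X x h) (isChain_subChain hwic hx h) (subChainCocone h) hx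
  exact ⟨_, _, .of_isColimit h _ (colimit.isColimit (subChain X x h))⟩

lemma ChainColimitsPreserve.le {ψ : C → Cardinal.{v}} (hψκ : E.ChainColimitsPreserve κ ψ)
    (hwic : WeaklyIdempotentComplete C) (hα : κ ≤ α.cof) (hx : ∀ i, E.IsAdmMono (x i))
    (h : ∀ i j, i ≤ j → ∃ f : X i ⟶ X j, f ≫ x j = x i)
    {lam : Cardinal.{v}} (hlam : lam.IsRegular) (hκlam : κ < lam) (hαlam : α.cof < lam)
    (hX : ∀ i, ψ (X i) ≤ lam) {P : C} {c : ∀ i, X i ⟶ P} (hc : IsChainColimit X x c) :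
    ψ P ≤ lam :=
  hψκ lam hlam hκlam α hα hαlam _ (isChain_subChain hwic hx h) (subChainCocone h) hx hX _
    (hc.nonempty_isColimit h)

lemma ChainColimitsAdmissible.isAdmMono (hκ : E.ChainColimitsAdmissible κ)
    (hwic : WeaklyIdempotentComplete C) (hα : κ ≤ α.cof) (hx : ∀ i, E.IsAdmMono (x i))
    (h : ∀ i j, i ≤ j → ∃ f : X i ⟶ X j, f ≫ x j = x i)
    {P : C} {c : ∀ i, X i ⟶ P} (hc : IsChainColimit X x c) (m : P ⟶ Z)
    (hm : ∀ i, c i ≫ m = x i) : E.IsAdmMono m := by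
  obtain ⟨hl⟩ := hc.nonempty_isColimit h
  have e : hl.desc (subChainCocone h) = m := hc.hom_ext _ _ fun i => by
    rw [hm]
    exact hl.fac _ i
  rw [← e]
  exact hκ α hα _ (isChain_subChain hwic hx h) (subChainCocone h) hx _ hl

end

/-- The ambient morphisms `z₁` and `z₂` make the sequences functorial in `i`: the squares with the
transition morphisms may be checked after composing with the monomorphisms into `Z₂` and `Z₃`. -/
lemma HasExactChainColimits.conflation (hE : E.HasExactChainColimits κ)
    (hwic : WeaklyIdempotentComplete C) (hα : κ ≤ α.cof)
    {Z₁ Z₂ Z₃ : C} {X₁ X₂ X₃ : Set.Iio α → C} {x₁ : ∀ i, X₁ i ⟶ Z₁} {x₂ : ∀ i, X₂ i ⟶ Z₂}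
    {x₃ : ∀ i, X₃ i ⟶ Z₃} [∀ i, Mono (x₁ i)] [∀ i, Mono (x₂ i)] [∀ i, Mono (x₃ i)]
    (hx₁ : ∀ i, E.IsAdmMono (x₁ i)) (hx₂ : ∀ i, E.IsAdmMono (x₂ i)) (hx₃ : ∀ i, E.IsAdmMono (x₃ i))
    (h₁ : ∀ i j, i ≤ j → ∃ f : X₁ i ⟶ X₁ j, f ≫ x₁ j = x₁ i)
    (h₂ : ∀ i j, i ≤ j → ∃ f : X₂ i ⟶ X₂ j, f ≫ x₂ j = x₂ i)
    (h₃ : ∀ i j, i ≤ j → ∃ f : X₃ i ⟶ X₃ j, f ≫ x₃ j = x₃ i)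
    {a : ∀ i, X₁ i ⟶ X₂ i} {q : ∀ i, X₂ i ⟶ X₃ i} {w : ∀ i, a i ≫ q i = 0}
    (hS : ∀ i, E.conflation (ShortComplex.mk (a i) (q i) (w i)))
    {z₁ : Z₁ ⟶ Z₂} {z₂ : Z₂ ⟶ Z₃} (hz₁ : ∀ i, a i ≫ x₂ i = x₁ i ≫ z₁)
    (hz₂ : ∀ i, q i ≫ x₃ i = x₂ i ≫ z₂)
    {P₁ P₂ P₃ : C} {c₁ : ∀ i, X₁ i ⟶ P₁} {c₂ : ∀ i, X₂ i ⟶ P₂} {c₃ : ∀ i, X₃ i ⟶ P₃}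
    (hc₁ : IsChainColimit X₁ x₁ c₁) (hc₂ : IsChainColimit X₂ x₂ c₂) (hc₃ : IsChainColimit X₃ x₃ c₃)
    {f : P₁ ⟶ P₂} {g : P₂ ⟶ P₃} (hf : ∀ i, c₁ i ≫ f = a i ≫ c₂ i)
    (hg : ∀ i, c₂ i ≫ g = q i ≫ c₃ i) :
    ∃ w : f ≫ g = 0, E.conflation (ShortComplex.mk f g w) := by
  have hw : f ≫ g = 0 := hc₁.hom_ext _ _ fun i => by
    rw [reassoc_of% hf, hg, reassoc_of% w, zero_comp, comp_zero]
  refine ⟨hw, ?_⟩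
  let F : Set.Iio α ⥤ ShortComplex C :=
    { obj := fun i => ShortComplex.mk (a i) (q i) (w i)
      map := fun {i j} φ =>
        { τ₁ := (subChain X₁ x₁ h₁).map φ
          τ₂ := (subChain X₂ x₂ h₂).map φ
          τ₃ := (subChain X₃ x₃ h₃).map φ
          comm₁₂ := by
            rw [← cancel_mono (x₂ j)]
            dsimp
            rw [Category.assoc, Category.assoc, hz₁, (h₂ _ _ (leOfHom φ)).choose_spec,
              reassoc_of% (h₁ _ _ (leOfHom φ)).choose_spec, hz₁]
          comm₂₃ := by
            rw [← cancel_mono (x₃ j)]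
            dsimp
            rw [Category.assoc, Category.assoc, hz₂, (h₃ _ _ (leOfHom φ)).choose_spec,
              reassoc_of% (h₂ _ _ (leOfHom φ)).choose_spec, hz₂] }
      map_id := fun i => by
        ext
        · exact (subChain X₁ x₁ h₁).map_id i
        · exact (subChain X₂ x₂ h₂).map_id i
        · exact (subChain X₃ x₃ h₃).map_id i
      map_comp := fun φ φ' => by
        ext
        · exact (subChain X₁ x₁ h₁).map_comp φ φ'
        · exact (subChain X₂ x₂ h₂).map_comp φ φ'
        · exact (subChain X₃ x₃ h₃).map_comp φ φ' }
  let c : Cocone F :=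
    { pt := ShortComplex.mk f g hw
      ι :=
        { app := fun i =>
            { τ₁ := c₁ i
              τ₂ := c₂ i
              τ₃ := c₃ i
              comm₁₂ := hf i
              comm₂₃ := hg i }
          naturality := fun i j φ => by
            ext
            · exact (hc₁.cocone h₁).ι.naturality φ
            · exact (hc₂.cocone h₂).ι.naturality φ
            · exact (hc₃.cocone h₃).ι.naturality φ } }
  exact hE.exact α hα F hS (isChain_subChain hwic hx₁ h₁) (isChain_subChain hwic hx₂ h₂)
    (isChain_subChain hwic hx₃ h₃) c (hc₁.nonempty_isColimit h₁) (hc₂.nonempty_isColimit h₂)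
    (hc₃.nonempty_isColimit h₃)

end ExactStructure

/-! ### Stages, and the factorization through a small exact complex. -/

namespace ExactStructure

variable {C : Type u} [Category.{v} C] [Preadditive C] [HasZeroObject C] [HasBinaryBiproducts C]

/-- A system of short exact sequences `A n ⟶ L n ⟶ N (n + 1)` of admissible subobjects in an exact
complex `M` with cycles `Z`, such that a morphism of complexes `g : K ⟶ M` factors through the
objects `L n`. -/
structure Stage (E : ExactStructure C) (P : C → Prop) {K M : CochainComplex C ℤ} (g : K ⟶ M)
    {Z : ℤ → C} (i : ∀ n, Z n ⟶ M.X n) (p : ∀ n, M.X n ⟶ Z (n + 1)) where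
  A : ℤ → C
  L : ℤ → C
  N : ℤ → C
  α : ∀ n, A n ⟶ Z n
  l : ∀ n, L n ⟶ M.X n
  ν : ∀ n, N n ⟶ Z n
  a : ∀ n, A n ⟶ L n
  q : ∀ n, L n ⟶ N (n + 1)
  k : ∀ n, K.X n ⟶ L n
  w : ∀ n, a n ≫ q n = 0
  conflation : ∀ n, E.conflation (ShortComplex.mk (a n) (q n) (w n))
  isAdmMono_α : ∀ n, E.IsAdmMono (α n)
  isAdmMono_l : ∀ n, E.IsAdmMono (l n)
  isAdmMono_ν : ∀ n, E.IsAdmMono (ν n)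
  prop_A : ∀ n, P (A n)
  prop_L : ∀ n, P (L n)
  prop_N : ∀ n, P (N n)
  a_l : ∀ n, a n ≫ l n = α n ≫ i n
  q_ν : ∀ n, q n ≫ ν (n + 1) = l n ≫ p n
  k_l : ∀ n, k n ≫ l n = g.f n

namespace Stage

variable {E : ExactStructure C} {P : C → Prop} {K M : CochainComplex C ℤ} {g : K ⟶ M}
  {Z : ℤ → C} {i : ∀ n, Z n ⟶ M.X n} {p : ∀ n, M.X n ⟶ Z (n + 1)}

/-- The relation "contained in, with interleaved cycles". -/
structure Rel (S T : Stage E P g i p) : Prop where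
  A_N : ∀ n, ∃ f : S.A n ⟶ T.N n, f ≫ T.ν n = S.α n
  N_N : ∀ n, ∃ f : S.N n ⟶ T.N n, f ≫ T.ν n = S.ν n
  N_A : ∀ n, ∃ f : S.N n ⟶ T.A n, f ≫ T.α n = S.ν n
  L_L : ∀ n, ∃ f : S.L n ⟶ T.L n, f ≫ T.l n = S.l n
  A_A : ∀ n, ∃ f : S.A n ⟶ T.A n, f ≫ T.α n = S.α n

variable {ψ : C → Cardinal.{v}} {lam κ : Cardinal.{v}}

/-- One component of the construction of an upper bound of a family of stages: given the
admissible subobject `N` of the cycles in degree `n + 1`, there is a subobject `L` of the term in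
degree `n`. -/
lemma exists_component (hwic : WeaklyIdempotentComplete C) (hψ : E.IsSizeFunction ψ)
    (hlam : lam.IsRegular) (hκ : κ.IsRegular) (hκlam : κ < lam)
    {Z₁ Z₂ X N : C} {i : Z₁ ⟶ X} {p : X ⟶ Z₂} {w : i ≫ p = 0}
    (hS : E.conflation (ShortComplex.mk i p w)) {ν : N ⟶ Z₂} (hν : E.IsAdmMono ν)
    (hN : E.IsBelow ψ lam κ N) {I : Type v} (hI : Cardinal.mk I < κ) (F : I → Over X)
    (hF : ∀ j, E.IsBelow ψ lam κ (F j).left)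
    (hFN : ∀ j, ∃ f : (F j).left ⟶ N, f ≫ ν = (F j).hom ≫ p) :
    ∃ (A L : C) (α : A ⟶ Z₁) (l : L ⟶ X) (a : A ⟶ L) (q : L ⟶ N) (w : a ≫ q = 0),
      E.conflation (ShortComplex.mk a q w) ∧ E.IsAdmMono α ∧ E.IsAdmMono l ∧
      E.IsBelow ψ lam κ A ∧ E.IsBelow ψ lam κ L ∧ a ≫ l = α ≫ i ∧ q ≫ ν = l ≫ p ∧
      ∀ j, ∃ f : (F j).left ⟶ L, f ≫ l = (F j).hom := by
  have := hν.mono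
  have hi := mono_of_conflation hS
  -- `B` is the preimage of `N` in `X`. Choosing `L` inside `B` forces its image into `N`, and
  -- letting `L` contain a small `D` that covers `N` makes `L ⟶ N` an admissible epimorphism.
  obtain ⟨B, b, r, sq, hb, hr⟩ := exists_isPullback (⟨_, _, _, hS⟩ : E.IsAdmEpi p) hν
  obtain ⟨D, d, hd, hD, hdr⟩ := IsBelow.cover hψ hlam hr hN
  choose f hf using hFN
  have hI' : Cardinal.mk (I ⊕ PUnit.{v + 1}) < κ := by
    rw [Cardinal.mk_sum]
    simpa using Cardinal.add_lt_of_lt hκ.aleph0_le hI (by simpa using hκ.nat_lt 1)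
  obtain ⟨L, l', hl', hL, hfac⟩ := IsBelow.factor hψ hlam hκ hκlam hI'
    (Sum.elim (fun j => Over.mk (sq.lift (F j).hom (f j) (hf j).symm)) (fun _ => Over.mk d))
    (by rintro (j | j) <;> simp [hF, hD])
  have hq : E.IsAdmEpi (l' ≫ r) := by
    obtain ⟨u, hu⟩ := hfac (Sum.inr PUnit.unit)
    refine IsAdmEpi.of_comp hwic (f := u) ?_
    rw [← Category.assoc]
    exact (congrArg (fun x => E.IsAdmEpi (x ≫ r)) hu).mpr hdr
  obtain ⟨A, a, w', ha⟩ := hq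
  obtain ⟨α, hα⟩ := exists_lift hS (a ≫ l' ≫ b) (by
    rw [Category.assoc, Category.assoc, sq.w, ← Category.assoc l', ← Category.assoc a, w', zero_comp])
  refine ⟨A, L, α, l' ≫ b, a, l' ≫ r, w', ha, IsAdmMono.of_comp hwic (g := i) ?_, hl'.comp hb,
    IsBelow.kernel hψ hlam hκ ha hL hN, hL, hα.symm, ?_, fun j => ?_⟩
  · rw [hα]
    exact IsAdmMono.comp ⟨_, _, _, ha⟩ (hl'.comp hb)
  · rw [Category.assoc, Category.assoc, sq.w]
  · obtain ⟨u, hu⟩ : ∃ u : (F j).left ⟶ L, u ≫ l' = sq.lift (F j).hom (f j) (hf j).symm :=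
      hfac (Sum.inl j)
    exact ⟨u, by rw [← Category.assoc, hu, sq.lift_fst]⟩

/-- The subobjects `N` are enlarged in all degrees before any `L` is chosen, so that `L n` depends
only on `N (n + 1)`; `A n` is then the resulting kernel. Including the image of `K` makes the empty
family admissible as well, which starts the recursion. Sizes are controlled degree by degree, with
no `β` common to all degrees. -/
lemma exists_upper_bound (hwic : WeaklyIdempotentComplete C) (hψ : E.IsSizeFunction ψ)
    (hlam : lam.IsRegular) (hκ : κ.IsRegular) (hκlam : κ < lam)
    (hK : ∀ n, ψ (K.X n) ≤ lam) {w : ∀ n, i n ≫ p n = 0}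
    (hS : ∀ n, E.conflation (ShortComplex.mk (i n) (p n) (w n)))
    {I : Type v} (hI : Cardinal.mk I < κ) (S : I → Stage E (E.IsBelow ψ lam κ) g i p) :
    ∃ T, ∀ j, (S j).Rel T := by
  have hK' : ∀ n, E.IsBelow ψ lam κ (K.X n) := fun n => IsBelow.of_le hκ (hK n)
  have h1 : Cardinal.mk PUnit.{v + 1} < κ := by simpa using hκ.nat_lt 1
  have hI' : Cardinal.mk ((I ⊕ I) ⊕ PUnit.{v + 1}) < κ := by
    rw [Cardinal.mk_sum, Cardinal.mk_sum]
    simpa using Cardinal.add_lt_of_lt hκ.aleph0_le (Cardinal.add_lt_of_lt hκ.aleph0_le hI hI) h1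
  have hN : ∀ n, ∃ (N : C) (ν : N ⟶ Z n), E.IsAdmMono ν ∧ E.IsBelow ψ lam κ N ∧
      (∀ j, ∃ f : (S j).N n ⟶ N, f ≫ ν = (S j).ν n) ∧
      (∀ j, ∃ f : (S j).A n ⟶ N, f ≫ ν = (S j).α n) ∧
      ∃ f : K.X (n - 1) ⟶ N, f ≫ ν = g.f (n - 1) ≫ p (n - 1) ≫ eqToHom (by simp) := by
    intro n
    obtain ⟨N, ν, hν, hN, hf⟩ := IsBelow.factor hψ hlam hκ hκlam hI'
      (Sum.elim (Sum.elim (fun j => Over.mk ((S j).ν n)) (fun j => Over.mk ((S j).α n)))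
        (fun _ => Over.mk (g.f (n - 1) ≫ p (n - 1) ≫ eqToHom (by simp) : _ ⟶ Z n)))
      (by rintro ((j | j) | j) <;> simp [prop_N, prop_A, hK'])
    exact ⟨N, ν, hν, hN, fun j => hf (Sum.inl (Sum.inl j)), fun j => hf (Sum.inl (Sum.inr j)),
      hf (Sum.inr PUnit.unit)⟩
  choose N ν hν hNP hNN hAN hKN using hN
  have hKN' : ∀ m n (h : m + 1 = n), ∃ f : K.X m ⟶ N n,
      f ≫ ν n = g.f m ≫ p m ≫ eqToHom (by rw [h]) := by
    intro m n h
    obtain rfl : m = n - 1 := by lia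
    exact hKN n
  have hL := fun n => exists_component hwic hψ hlam hκ hκlam (hS n) (hν (n + 1)) (hNP (n + 1)) hI'
    (Sum.elim (Sum.elim (fun j => Over.mk ((S j).ν n ≫ i n)) (fun j => Over.mk ((S j).l n)))
        (fun _ => Over.mk (g.f n)))
    (by rintro ((j | j) | j) <;> simp [prop_N, prop_L, hK'])
    -- Everything put into `L n` must project into `N (n + 1)`: the old `N n` consists of cycles and
    -- projects to zero, while the old `L n` and `K.X n` project into subobjects that `N (n + 1)`
    -- contains by choice.
    (by
      rintro ((j | j) | j)
      · refine ⟨(0 : (S j).N n ⟶ N (n + 1)), ?_⟩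
        change (0 : (S j).N n ⟶ N (n + 1)) ≫ ν (n + 1) = ((S j).ν n ≫ i n) ≫ p n
        rw [Category.assoc, w, comp_zero, zero_comp]
      · obtain ⟨f, hf⟩ := hNN (n + 1) j
        exact ⟨(S j).q n ≫ f, by simp [hf, q_ν]⟩
      · obtain ⟨f, hf⟩ := hKN' n (n + 1) rfl
        exact ⟨f, by simpa using hf⟩)
  choose A L α l a q w' hc hα hl hA hL ha hq hf using hL
  have hLk : ∀ n, ∃ f : K.X n ⟶ L n, f ≫ l n = g.f n := fun n => hf n (Sum.inr PUnit.unit)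
  choose k hk using hLk
  have hi : ∀ n, Mono (i n) := fun n => mono_of_conflation (hS n)
  have hlm : ∀ n, Mono (l n) := fun n => (hl n).mono
  have hνm : ∀ n, Mono (ν n) := fun n => (hν n).mono
  -- The old `N n` was put into `L n` and is killed by `q n`, so it lies in the kernel `A n`.
  have hNA : ∀ j n, ∃ f : (S j).N n ⟶ A n, f ≫ α n = (S j).ν n := by
    intro j n
    obtain ⟨f, hf⟩ : ∃ f : (S j).N n ⟶ L n, f ≫ l n = (S j).ν n ≫ i n :=
      hf n (Sum.inl (Sum.inl j))
    obtain ⟨f', hf'⟩ := exists_lift (hc n) f (by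
      rw [← cancel_mono (ν (n + 1)), Category.assoc, hq, reassoc_of% hf, w]
      simp)
    refine ⟨f', ?_⟩
    rw [← cancel_mono (i n), Category.assoc, ← ha, reassoc_of% hf', hf]
  have hLL : ∀ j n, ∃ f : (S j).L n ⟶ L n, f ≫ l n = (S j).l n := fun j n =>
    hf n (Sum.inl (Sum.inr j))
  have hAA : ∀ j n, ∃ f : (S j).A n ⟶ A n, f ≫ α n = (S j).α n := by
    intro j n
    obtain ⟨f, hf⟩ := hLL j n
    obtain ⟨f', hf'⟩ := exists_lift (hc n) ((S j).a n ≫ f) (by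
      rw [← cancel_mono (ν (n + 1)), Category.assoc, Category.assoc, hq, reassoc_of% hf,
        reassoc_of% (S j).a_l, w]
      simp)
    refine ⟨f', ?_⟩
    rw [← cancel_mono (i n), Category.assoc, ← ha, reassoc_of% hf', hf, (S j).a_l]
  exact ⟨⟨A, L, N, α, l, ν, a, q, k, w', hc, hα, hl, hν, hA, hL, hNP, ha, hq, hk⟩, fun j =>
    ⟨fun n => hAN n j, fun n => hNN n j, hNA j, hLL j, hAA j⟩⟩

end Stage

/-- A morphism from a complex with terms of size at most `lam` to an exact complex factors through
an exact complex with terms and cycles of size at most `φ_κ(lam)`. -/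
theorem exists_factorization {E : ExactStructure C} (hwic : WeaklyIdempotentComplete C)
    {κ : Cardinal.{v}} (hκ : κ.IsRegular) (hE : E.HasExactChainColimits κ)
    {ψ : C → Cardinal.{v}} (hψ : E.IsSizeFunction ψ) (hψκ : E.ChainColimitsPreserve κ ψ)
    {lam : Cardinal.{v}} (hlam : lam.IsRegular) (hκlam : κ < lam)
    {K M : CochainComplex C ℤ} (g : K ⟶ M) (hK : ∀ n, ψ (K.X n) ≤ lam) (hM : E.IsExactComplex M) :
    ∃ (L : CochainComplex C ℤ) (k : K ⟶ L) (m : L ⟶ M),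
      E.IsExactComplexIn (fun X => ψ X ≤ E.phiLower ψ lam κ.ord) L ∧ k ≫ m = g ∧
      (E.ChainColimitsAdmissible κ → ∀ n, E.IsAdmMono (m.f n)) := by
  obtain ⟨-, Z, i, p, w, -, hS, hd⟩ := hM
  obtain ⟨S, hSR⟩ := exists_increasing_sequence (κ := κ)
    (Stage.Rel (E := E) (P := E.IsBelow ψ lam κ) (g := g) (i := i) (p := p))
    (fun I hI S => Stage.exists_upper_bound hwic hψ hlam hκ hκlam hK hS hI S)
  have hcof : κ ≤ κ.ord.cof := hκ.cof_ord.ge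
  obtain ⟨hμ, hlamμ⟩ := phiLower_isRegular (E := E) (ψ := ψ) hlam hκ
  have hκμ := hκlam.trans_le hlamμ
  have hcofμ : κ.ord.cof < E.phiLower ψ lam κ.ord := by rwa [hκ.cof_ord]
  have hi : ∀ n, Mono (i n) := fun n => mono_of_conflation (hS n)
  have hα : ∀ n j, Mono ((S j).α n) := fun n j => ((S j).isAdmMono_α n).mono
  have hl : ∀ n j, Mono ((S j).l n) := fun n j => ((S j).isAdmMono_l n).mono
  have hν : ∀ n j, Mono ((S j).ν n) := fun n j => ((S j).isAdmMono_ν n).mono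
  have hAA : ∀ n j j', j ≤ j' → ∃ f : (S j).A n ⟶ (S j').A n, f ≫ (S j').α n = (S j).α n := by
    intro n j j' h
    obtain rfl | h := h.eq_or_lt
    · exact ⟨𝟙 _, Category.id_comp _⟩
    · exact (hSR j j' h).A_A n
  have hLL : ∀ n j j', j ≤ j' → ∃ f : (S j).L n ⟶ (S j').L n, f ≫ (S j').l n = (S j).l n := by
    intro n j j' h
    obtain rfl | h := h.eq_or_lt
    · exact ⟨𝟙 _, Category.id_comp _⟩
    · exact (hSR j j' h).L_L n
  have hNN : ∀ n j j', j ≤ j' → ∃ f : (S j).N n ⟶ (S j').N n, f ≫ (S j').ν n = (S j).ν n := by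
    intro n j j' h
    obtain rfl | h := h.eq_or_lt
    · exact ⟨𝟙 _, Category.id_comp _⟩
    · exact (hSR j j' h).N_N n
  have hlim := Cardinal.isSuccLimit_ord hκ.aleph0_le
  have hsucc : ∀ j : Set.Iio κ.ord, ∃ j' : Set.Iio κ.ord, j < j' := fun j =>
    ⟨⟨j.1 + 1, hlim.add_one_lt j.2⟩, Subtype.mk_lt_mk.mpr (lt_add_one j.1)⟩
  choose PN cN hcN using fun n =>
    hE.exists_isChainColimit hwic hcof (fun j => (S j).isAdmMono_ν n) (hNN n)
  choose PL cL hcL using fun n =>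
    hE.exists_isChainColimit hwic hcof (fun j => (S j).isAdmMono_l n) (hLL n)
  -- The inclusions of each `A` in a later `N` and of each `N` in a later `A` give both chains the
  -- same colimit `PN n`, which becomes the cycle object of `L`.
  choose cA hcA hAN hNA using fun n => (hcN n).interleave (hNN n) (hAA n)
    (fun j => (hsucc j).imp fun j' h => (hSR j j' h).N_A n)
    (fun j => (hsucc j).imp fun j' h => (hSR j j' h).A_N n)
  have hιL : ∀ n, ∃ f : PN n ⟶ PL n, ∀ j, cA n j ≫ f = (S j).a n ≫ cL n j := by
    intro n
    refine (hcA n).desc _ fun j j' f hf => ?_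
    rw [← Category.assoc]
    refine (hcL n).comp_eq_of_comp_eq (hLL n) _ _ ?_
    rw [Category.assoc, (S j').a_l, (S j).a_l, reassoc_of% hf]
  choose ιL hιL using hιL
  have hπL : ∀ n, ∃ f : PL n ⟶ PN (n + 1), ∀ j, cL n j ≫ f = (S j).q n ≫ cN (n + 1) j := by
    intro n
    refine (hcL n).desc _ fun j j' f hf => ?_
    rw [← Category.assoc]
    refine (hcN (n + 1)).comp_eq_of_comp_eq (hNN (n + 1)) _ _ ?_
    rw [Category.assoc, (S j').q_ν, (S j).q_ν, reassoc_of% hf]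
  choose πL hπL using hπL
  choose wL hconf using fun n => hE.conflation hwic hcof (fun j => (S j).isAdmMono_α n)
    (fun j => (S j).isAdmMono_l n) (fun j => (S j).isAdmMono_ν (n + 1)) (hAA n) (hLL n)
    (hNN (n + 1)) (fun j => (S j).conflation n) (fun j => (S j).a_l n) (fun j => (S j).q_ν n)
    (hcA n) (hcL n) (hcN (n + 1)) (hιL n) (hπL n)
  choose m hm using fun n => (hcL n).desc (fun j => (S j).l n) (fun j j' f hf => hf)
  choose z hz using fun n => (hcN n).desc (fun j => (S j).ν n) (fun j j' f hf => hf)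
  have hzA : ∀ n j, cA n j ≫ z n = (S j).α n := by
    intro n j
    obtain ⟨j', h⟩ := hsucc j
    obtain ⟨f, hf⟩ := (hSR j j' h).A_N n
    rw [← hAN n j j' f hf, Category.assoc, hz, hf]
  have hmz : ∀ n, ιL n ≫ m n = z n ≫ i n := fun n => (hcA n).hom_ext _ _ fun j => by
    rw [reassoc_of% hιL, hm, (S j).a_l, reassoc_of% hzA]
  have hzm : ∀ n, πL n ≫ z (n + 1) = m n ≫ p n := fun n => (hcL n).hom_ext _ _ fun j => by
    rw [reassoc_of% hπL, hz, (S j).q_ν, reassoc_of% hm]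
  -- At stage `j` alone the differential of `L` is undefined, since `N (n + 1)` need not lie in `A
  -- (n + 1)`. It does lie in the `A (n + 1)` of a later stage `j'`, where the two sides are
  -- compared inside `M`.
  have hlk : ∀ n j, (S j).k n ≫ cL n j ≫ πL n ≫ ιL (n + 1) =
      K.d n (n + 1) ≫ (S j).k (n + 1) ≫ cL (n + 1) j := by
    intro n j
    obtain ⟨j', h⟩ := hsucc j
    obtain ⟨f, hf⟩ := (hSR j j' h).N_A (n + 1)
    obtain ⟨f', hf'⟩ := (hSR j j' h).L_L (n + 1)
    rw [reassoc_of% hπL, ← hNA (n + 1) j j' f hf, Category.assoc, hιL,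
      ← (hcL (n + 1)).w f' hf']
    simp only [← Category.assoc]
    congr 1
    rw [← cancel_mono ((S j').l (n + 1))]
    simp only [Category.assoc]
    rw [hf', (S j).k_l, (S j').a_l, reassoc_of% hf, reassoc_of% (S j).q_ν,
      reassoc_of% (S j).k_l, hd, g.comm]
  let L : CochainComplex C ℤ := CochainComplex.of PL (fun n => πL n ≫ ιL (n + 1)) (fun n => by
    rw [Category.assoc, reassoc_of% wL, zero_comp, comp_zero])
  have hLd : ∀ n, L.d n (n + 1) = πL n ≫ ιL (n + 1) := fun n => 
    CochainComplex.of_d PL (fun n => πL n ≫ ιL (n + 1)) n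
  let j₀ : Set.Iio κ.ord := ⟨0, hκ.ord_pos⟩
  let k : K ⟶ L :=
    { f := fun n => (S j₀).k n ≫ cL n j₀
      comm' := by
        rintro n _ rfl
        rw [hLd, Category.assoc, hlk] }
  let m' : L ⟶ M :=
    { f := m
      comm' := by
        rintro n _ rfl
        rw [hLd, Category.assoc, hmz, reassoc_of% hzm, hd] }
  refine ⟨L, k, m', ⟨fun n => ?_, PN, ιL, πL, wL, fun n => ?_, hconf, fun n => (hLd n).symm⟩, ?_,
    fun hadm n => ?_⟩
  · exact hψκ.le hwic hcof (fun j => (S j).isAdmMono_l n) (hLL n) hμ hκμ hcofμ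
      (fun j => ((S j).prop_L n).le_phiLower hκ) (hcL n)
  · exact hψκ.le hwic hcof (fun j => (S j).isAdmMono_ν n) (hNN n) hμ hκμ hcofμ
      (fun j => ((S j).prop_N n).le_phiLower hκ) (hcN n)
  · ext n
    change ((S j₀).k n ≫ cL n j₀) ≫ m n = g.f n
    rw [Category.assoc, hm, (S j₀).k_l]
  · exact hadm.isAdmMono hwic hcof (fun j => (S j).isAdmMono_l n) (hLL n) (hcL n) (m n) (hm n)

end ExactStructure

/-! ### Exactness of mapping cones. -/

namespace ExactStructure

variable {C : Type u} [Category.{v} C] [Preadditive C] [HasZeroObject C] [HasBinaryBiproducts C]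
  {E : ExactStructure C}

/-- The second morphism is `𝟙 ⊕ p` followed by the cokernel `M ⊞ W ⟶ Q` of `(-i, z)`. Its kernel is
therefore the pullback of `p` along `z`, and that is `P` because `P` and `N` are extensions with the
same subobject `A`. In a mapping cone, `P` and `Q` are consecutive cycle objects. -/
lemma conflation_of_pushout_pullback {Z₁ M N A P W Q : C} {i : Z₁ ⟶ M} (hi : E.IsAdmMono i)
    {z : Z₁ ⟶ W} {u : M ⟶ Q} {v : W ⟶ Q} (sq : IsPushout i z u v)
    {j : A ⟶ N} {p : N ⟶ W} {wj : j ≫ p = 0} (hN : E.conflation (ShortComplex.mk j p wj))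
    {b : A ⟶ P} {r : P ⟶ Z₁} {wb : b ≫ r = 0} (hP : E.conflation (ShortComplex.mk b r wb))
    {t : P ⟶ N} (hb : b ≫ t = j) (ht : t ≫ p = r ≫ z) :
    ∃ w : biprod.lift (-(r ≫ i)) t ≫ biprod.desc u (p ≫ v) = 0,
      E.conflation (ShortComplex.mk (biprod.lift (-(r ≫ i)) t) (biprod.desc u (p ≫ v)) w) := by
  have him := hi.mono
  have e : biprod.desc u (p ≫ v) = biprod.map (𝟙 M) p ≫ biprod.desc u v := by ext <;> simp
  have hsq := conflation_of_isPushout hi sq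
  have hepi : E.IsAdmEpi (biprod.desc u (p ≫ v)) := by
    rw [e]
    exact (IsAdmEpi.biprod_map_id ⟨_, _, _, hN⟩ M).comp ⟨_, _, _, hsq⟩
  have w : biprod.lift (-(r ≫ i)) t ≫ biprod.desc u (p ≫ v) = 0 := by
    simp [sq.w, reassoc_of% ht]
  have hmono : Mono (biprod.lift (-(r ≫ i)) t) := by
    refine Preadditive.mono_of_cancel_zero _ fun {T} c hc => ?_
    refine eq_zero_of_morphism hP hN hb c ?_ ?_
    · simpa using hc =≫ biprod.snd
    · have := hc =≫ biprod.fst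
      simp only [Category.assoc, biprod.lift_fst, Preadditive.comp_neg, zero_comp,
        neg_eq_zero] at this
      rwa [← cancel_mono i, zero_comp, Category.assoc]
  refine ⟨w, hepi.conflation w fun T s hs => ?_⟩
  obtain ⟨a, ha⟩ := exists_lift hsq (s ≫ biprod.map (𝟙 M) p) (by
    rw [Category.assoc, ← e, hs])
  have ha₁ : -(a ≫ i) = s ≫ biprod.fst := by simpa using ha =≫ biprod.fst
  have ha₂ : a ≫ z = s ≫ biprod.snd ≫ p := by simpa using ha =≫ biprod.snd
  obtain ⟨c, hc₁, hc₂⟩ := exists_lift_of_morphism hP hN hb ht (s ≫ biprod.snd) a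
    (by rw [Category.assoc, ha₂])
  refine ⟨c, ?_⟩
  ext
  · simp [reassoc_of% hc₂, ← ha₁]
  · simp [hc₁]

/-- Exactness of a complex, with the second morphisms of the short exact sequences indexed by
pairs of consecutive integers. -/
lemma isExactComplex_iff (M : CochainComplex C ℤ) :
    E.IsExactComplex M ↔ ∃ (Z : ℤ → C) (i : ∀ n, Z n ⟶ M.X n)
      (p : ∀ n m, n + 1 = m → (M.X n ⟶ Z m)) (w : ∀ n m h, i n ≫ p n m h = 0),
      (∀ n m h, E.conflation (ShortComplex.mk (i n) (p n m h) (w n m h))) ∧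
      ∀ n m h, p n m h ≫ i m = M.d n m := by
  constructor
  · rintro ⟨-, Z, i, p, w, -, hc, hd⟩
    refine ⟨Z, i, fun n m h => p n ≫ eqToHom (by rw [h]), ?_, ?_, ?_⟩
    · rintro n m rfl
      simp [w]
    · rintro n m rfl
      simpa using hc n
    · rintro n m rfl
      simpa using hd n
  · rintro ⟨Z, i, p, w, hc, hd⟩
    exact ⟨fun _ => trivial, Z, i, fun n => p n (n + 1) rfl, fun n => w _ _ rfl, fun _ => trivial,
      fun n => hc _ _ rfl, fun n => hd _ _ rfl⟩

open CochainComplex HomComplex in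
/-- The mapping cone of a morphism between exact complexes is exact. -/
lemma IsExactComplex.mappingCone {M N : CochainComplex C ℤ} (hM : E.IsExactComplex M)
    (hN : E.IsExactComplex N) (φ : M ⟶ N) : E.IsExactComplex (CochainComplex.mappingCone φ) := by
  rw [isExactComplex_iff] at hM
  obtain ⟨-, ZN, iN, pN, wN, -, hcN, hdN⟩ := hN
  obtain ⟨ZM, iM, pM, wM, hcM, hdM⟩ := hM
  have hiN : ∀ n, Mono (iN n) := fun n => mono_of_conflation (hcN n)
  have hpM : ∀ n, Epi (pM n _ rfl) := fun n => epi_of_conflation (hcM n _ rfl)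
  have hz : ∀ n, ∃ z : ZM n ⟶ ZN n, z ≫ iN n = iM n ≫ φ.f n := by
    intro n
    refine exists_lift (hcN n) _ ?_
    have h₁ : iM n ≫ M.d n (n + 1) = 0 := by
      rw [← hdM n _ rfl, reassoc_of% wM, zero_comp]
    rw [← cancel_mono (iN (n + 1)), Category.assoc, Category.assoc, hdN, φ.comm,
      reassoc_of% h₁, zero_comp, zero_comp]
  choose z hz using hz
  have hz' : ∀ n, pM n _ rfl ≫ z (n + 1) = φ.f n ≫ pN n := by
    intro n
    rw [← cancel_mono (iN (n + 1)), Category.assoc, Category.assoc, hz, hdN,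
      reassoc_of% hdM n _ rfl, φ.comm]
  -- The cycles of the cone in degree `n` are the pushout of `M.X n` and `ZN n` over `ZM n`, an
  -- extension of `ZM (n + 1)` by `ZN n`.
  choose P u v r wr sq hur hcP using fun n => exists_pushout_conflation (hcM n _ rfl) (z n)
  let t : ∀ n, P n ⟶ N.X n := fun n => (sq n).desc (φ.f n) (iN n) (hz n).symm
  have hut : ∀ n, u n ≫ t n = φ.f n := fun n => (sq n).inl_desc _ _ _
  have hvt : ∀ n, v n ≫ t n = iN n := fun n => (sq n).inr_desc _ _ _
  have htp : ∀ n, t n ≫ pN n = r n ≫ z (n + 1) := fun n => (sq n).hom_ext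
    (by rw [reassoc_of% hut, reassoc_of% hur, hz'])
    (by rw [reassoc_of% hvt, wN, reassoc_of% wr, zero_comp])
  choose w hc using fun n => conflation_of_pushout_pullback ⟨_, _, _, hcM (n + 1) _ rfl⟩
    (sq (n + 1)) (hcN n) (hcP n) (hvt n) (htp n)
  let e : ∀ n, M.X (n + 1) ⊞ N.X n ≅ (CochainComplex.mappingCone φ).X n := fun n =>
    { hom := biprod.desc ((mappingCone.inl φ).v (n + 1) n (by lia)) ((mappingCone.inr φ).f n)
      inv := biprod.lift ((mappingCone.fst φ).1.v n (n + 1) rfl)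
        ((mappingCone.snd φ).v n n (add_zero n))
      hom_inv_id := by ext <;> simp
      inv_hom_id := by simp [biprod.lift_desc, mappingCone.id_X] }
  have w' : ∀ n, (biprod.lift (-(r n ≫ iM (n + 1))) (t n) ≫ (e n).hom) ≫
      (e n).inv ≫ biprod.desc (u (n + 1)) (pN n ≫ v (n + 1)) = 0 := fun n => by
    simp only [Category.assoc, Iso.hom_inv_id_assoc, w]
  refine ⟨fun _ => trivial, P, fun n => biprod.lift (-(r n ≫ iM (n + 1))) (t n) ≫ (e n).hom,
    fun n => (e n).inv ≫ biprod.desc (u (n + 1)) (pN n ≫ v (n + 1)), w', fun _ => trivial,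
    fun n => conflation_of_isos (hc n) _ (Iso.refl _) (e n) (Iso.refl _) (by simp) (by simp),
    fun n => ?_⟩
  have hd : (CochainComplex.mappingCone φ).d n (n + 1) = (e n).inv ≫
      (biprod.desc (biprod.lift (-M.d (n + 1) (n + 1 + 1)) (φ.f (n + 1)))
        (biprod.lift 0 (N.d n (n + 1)))) ≫ (e (n + 1)).hom := by
    rw [Iso.eq_inv_comp]
    ext
    · simp [e, mappingCone.inl_v_d φ (n + 1) n (n + 1 + 1) (by lia) (by lia), biprod.lift_desc,
        sub_eq_neg_add]
    · simp [e, biprod.lift_desc]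
  rw [hd, Category.assoc, ← Category.assoc (biprod.desc _ _)]
  congr 2
  ext
  · simp [reassoc_of% hur, hdM]
  · simp [hut]
  · simp [reassoc_of% wr]
  · simp [hvt, hdN]

end ExactStructure

/-! ### Exact complexes as a triangulated subcategory, and smallness of Hom sets. -/

namespace ExactStructure

variable {C : Type u} [Category.{v} C] [Preadditive C] [HasZeroObject C] [HasBinaryBiproducts C]
  {E : ExactStructure C}

lemma IsExactComplex.of_iso {M N : CochainComplex C ℤ} (hM : E.IsExactComplex M) (e : M ≅ N) :
    E.IsExactComplex N := by
  obtain ⟨-, Z, i, p, w, -, hc, hd⟩ := hM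
  have he : ∀ n, e.hom.f n ≫ e.inv.f n = 𝟙 _ := fun n => by
    rw [← HomologicalComplex.comp_f, e.hom_inv_id, HomologicalComplex.id_f]
  have he' : ∀ n, e.inv.f n ≫ e.hom.f n = 𝟙 _ := fun n => by
    rw [← HomologicalComplex.comp_f, e.inv_hom_id, HomologicalComplex.id_f]
  refine ⟨fun _ => trivial, Z, fun n => i n ≫ e.hom.f n, fun n => e.inv.f n ≫ p n,
    fun n => by rw [Category.assoc, reassoc_of% he, w], fun _ => trivial, fun n => ?_, fun n => ?_⟩
  · exact conflation_of_isos (hc n) _ (Iso.refl _) (HomologicalComplex.Hom.isoApp e n) (Iso.refl _)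
      (by simp) (by simp)
  · rw [Category.assoc, reassoc_of% hd, ← e.hom.comm, ← Category.assoc, he', Category.id_comp]

lemma IsExactComplex.shift {M : CochainComplex C ℤ} (hM : E.IsExactComplex M) (k : ℤ) :
    E.IsExactComplex (M⟦k⟧) := by
  rw [isExactComplex_iff] at hM ⊢
  obtain ⟨Z, i, p, w, hc, hd⟩ := hM
  -- The differential of `M⟦k⟧` carries the sign `(-1)^k`, which is absorbed into the epimorphisms
  -- onto the cycles.
  let c : ∀ n, Z n ≅ Z n := fun n =>
    { hom := k.negOnePow • 𝟙 (Z n)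
      inv := k.negOnePow • 𝟙 (Z n)
      hom_inv_id := by simp [smul_smul]
      inv_hom_id := by simp [smul_smul] }
  have w' : ∀ n m (h : n + 1 = m), i (n + k) ≫ p (n + k) (m + k) (by lia) ≫ (c (m + k)).hom = 0 :=
    fun n m h => by rw [reassoc_of% w, zero_comp]
  refine ⟨fun n => Z (n + k), fun n => i (n + k),
    fun n m h => p (n + k) (m + k) (by lia) ≫ (c (m + k)).hom, w', fun n m h => ?_,
    fun n m h => ?_⟩
  · exact conflation_of_isos (hc (n + k) (m + k) (by lia)) (w' n m h) (Iso.refl _) (Iso.refl _)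
      (c (m + k)) (by simp) (by simp)
  · have := hd (n + k) (m + k) (by lia)
    simp [c, this]

variable (E) in
lemma isExactComplex_of_isZero {M : CochainComplex C ℤ} (hM : ∀ n, IsZero (M.X n)) :
    E.IsExactComplex M := by
  refine ⟨fun _ => trivial, fun n => M.X n, fun n => 𝟙 _, fun n => 0, fun n => comp_zero,
    fun _ => trivial, fun n => ?_, fun n => (hM n).eq_of_src _ _⟩
  exact (E.isAdmEpi_to_isZero (hM (n + 1)) _).conflation _ fun T t _ => ⟨t, Category.comp_id t⟩

instance : E.acyclic.IsClosedUnderIsomorphisms where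
  of_iso e := fun ⟨M, hM, ⟨e'⟩⟩ => ⟨M, hM, ⟨e.symm ≪≫ e'⟩⟩

lemma acyclic_of_isExactComplex {M : CochainComplex C ℤ} (hM : E.IsExactComplex M) :
    E.acyclic ((HomotopyCategory.quotient C (ComplexShape.up ℤ)).obj M) :=
  ⟨M, hM, ⟨Iso.refl _⟩⟩

open ZeroObject in
instance : E.acyclic.ContainsZero where
  exists_zero := ⟨(HomotopyCategory.quotient C (ComplexShape.up ℤ)).obj 0,
    Functor.map_isZero _ (isZero_zero _),
    acyclic_of_isExactComplex (E.isExactComplex_of_isZero fun n =>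
      Functor.map_isZero (HomologicalComplex.eval C (ComplexShape.up ℤ) n) (isZero_zero _))⟩

instance : E.acyclic.IsStableUnderShift ℤ where
  isStableUnderShiftBy k :=
    { le_shift := by
        rintro X ⟨M, hM, ⟨e⟩⟩
        exact ⟨M⟦k⟧, hM.shift k, ⟨(shiftFunctor _ k).mapIso e ≪≫
          (((HomotopyCategory.quotient C (ComplexShape.up ℤ)).commShiftIso k).app M).symm⟩⟩ }

open Pretriangulated in
instance : E.acyclic.IsTriangulatedClosed₃ := .mk' <| by
  rintro T hT ⟨M, hM, ⟨e₁⟩⟩ ⟨N, hN, ⟨e₂⟩⟩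
  obtain ⟨φ, hφ⟩ := (HomotopyCategory.quotient C (ComplexShape.up ℤ)).map_surjective
    (e₁.inv ≫ T.mor₁ ≫ e₂.hom)
  let e := isoTriangleOfIso₁₂ _ _ hT (HomotopyCategory.mappingCone_triangleh_distinguished φ) e₁ e₂
    (by
      change _ = e₁.hom ≫ (HomotopyCategory.quotient C (ComplexShape.up ℤ)).map φ
      rw [hφ, Iso.hom_inv_id_assoc]
      rfl)
  exact ⟨_, hM.mappingCone hN φ, ⟨Triangle.π₃.mapIso e⟩⟩

instance : E.acyclic.IsTriangulated where
  toIsTriangulatedClosed₂ := .of_isTriangulatedClosed₃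

/-- Complexes with terms in an essentially small class of objects are isomorphic to the members of
a small family of complexes. -/
lemma exists_small_complexes {D : Type u} [Category.{v} D] [HasZeroMorphisms D]
    (P : ObjectProperty D) [hP : ObjectProperty.EssentiallySmall.{v} P] :
    ∃ (S : ObjectProperty (CochainComplex D ℤ)), Small.{v} (Subtype S) ∧
      ∀ L : CochainComplex D ℤ, (∀ n, P (L.X n)) → ∃ L', S L' ∧ Nonempty (L ≅ L') := by
  obtain ⟨Q, _, hQ⟩ := hP.exists_small_le'
  refine ⟨fun L => ∀ n, Q (L.X n), ?_, fun L hL => ?_⟩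
  -- A complex is determined by its terms and differentials; with terms from a small set these form
  -- a small type.
  · let Φ : {L : CochainComplex D ℤ // ∀ n, Q (L.X n)} →
        Σ X : ℤ → Subtype Q, ∀ i j, (X i).1 ⟶ (X j).1 :=
      fun L => ⟨fun n => ⟨L.1.X n, L.2 n⟩, fun i j => L.1.d i j⟩
    refine small_of_injective (f := Φ) ?_
    rintro ⟨⟨X, d, _, _⟩, hL⟩ ⟨⟨X', d', _, _⟩, hL'⟩ h
    simp only [Φ, Sigma.mk.injEq] at h
    obtain ⟨h₁, h₂⟩ := h
    obtain rfl : X = X' := funext fun n => congrArg Subtype.val (congrFun h₁ n)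
    obtain rfl : d = d' := eq_of_heq h₂
    rfl
  · choose X hX e using fun n => hQ _ (hL n)
    let e := fun n => (e n).some
    let L' : CochainComplex D ℤ :=
      { X := X
        d := fun i j => (e i).inv ≫ L.d i j ≫ (e j).hom
        shape := fun i j hij => by rw [L.shape i j hij, zero_comp, comp_zero] }
    exact ⟨L', hX, ⟨HomologicalComplex.Hom.isoOfComponents e (fun i j _ => by simp [L'])⟩⟩

open Pretriangulated in
-- The fractions with denominator the fibre of some `K ⟶ L'`, for `L'` exact in a fixed small
-- family, already exhaust the morphisms.
lemma small_hom {κ : Cardinal.{v}} (hwic : WeaklyIdempotentComplete C) (hκ : κ.IsRegular)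
    (hE : E.HasExactChainColimits κ) {ψ : C → Cardinal.{v}} (hψ : E.IsSizeFunction ψ)
    (hψκ : E.ChainColimitsPreserve κ ψ) (K : CochainComplex C ℤ)
    (Y : HomotopyCategory C (ComplexShape.up ℤ)) :
    Small.{v} (E.acyclic.trW.Q.obj ((HomotopyCategory.quotient C (ComplexShape.up ℤ)).obj K) ⟶
      E.acyclic.trW.Q.obj Y) := by
  let q := HomotopyCategory.quotient C (ComplexShape.up ℤ)
  let W := E.acyclic.trW
  obtain ⟨lam, hlam, hκlam, hK⟩ :=
    exists_isRegular_gt κ (fun n : ULift.{v} ℤ => ψ (K.X n.down))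
  obtain ⟨hμ, -⟩ := phiLower_isRegular (E := E) (ψ := ψ) hlam hκ
  have := hψ.small _ (Or.inr hμ)
  obtain ⟨S, _, hS⟩ := exists_small_complexes (fun X : C => ψ X ≤ E.phiLower ψ lam κ.ord)
  let I := {x : Σ L : Subtype S, (q.obj K ⟶ q.obj L.1) // E.IsExactComplex x.1.1}
  have hfib : ∀ x : I, ∃ (V : HomotopyCategory C (ComplexShape.up ℤ)) (s : V ⟶ q.obj K),
      W s ∧ s ≫ x.1.2 = 0 := by
    intro x
    obtain ⟨V, s, h, hT⟩ := distinguished_cocone_triangle₁ x.1.2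
    exact ⟨V, s, ⟨_, _, _, hT, acyclic_of_isExactComplex x.2⟩, comp_distTriang_mor_zero₁₂ _ hT⟩
  choose V s hs hsx using hfib
  have hsQ : ∀ x, IsIso (W.Q.map (s x)) := fun x => Localization.inverts W.Q W _ (hs x)
  let Φ : (Σ x : I, (V x ⟶ Y)) → (W.Q.obj (q.obj K) ⟶ W.Q.obj Y) := fun x =>
    inv (W.Q.map (s x.1)) ≫ W.Q.map x.2
  refine small_of_surjective (f := Φ) fun φ => ?_
  obtain ⟨r, rfl⟩ := Localization.exists_rightFraction W.Q W φ
  -- `g` is the morphism from `K` to the cone of the denominator; it lifts to a morphism of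
  -- complexes into the exact complex `M`.
  obtain ⟨Z, g, h, hT, M, hM, ⟨e⟩⟩ := r.hs
  obtain ⟨g', hg'⟩ := q.map_surjective (g ≫ e.hom)
  obtain ⟨L, k, m, hL, hkm, -⟩ :=
    exists_factorization hwic hκ hE hψ hψκ hlam hκlam g' (fun n => hK ⟨n⟩) hM
  obtain ⟨L', hL', ⟨a⟩⟩ := hS L hL.1
  have hLe : E.IsExactComplex L := by
    obtain ⟨-, Z, i, p, w, -, h⟩ := hL
    exact ⟨fun _ => trivial, Z, i, p, w, fun _ => trivial, h⟩
  let x : I := ⟨⟨⟨L', hL'⟩, q.map (k ≫ a.hom)⟩, hLe.of_iso a⟩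
  have hsg : s x ≫ g = 0 := by
    have h₁ : g = x.1.2 ≫ q.map (a.inv ≫ m) ≫ e.inv := by
      change _ = q.map (k ≫ a.hom) ≫ _
      rw [← q.map_comp_assoc, Category.assoc, a.hom_inv_id_assoc, hkm, hg', Category.assoc,
        e.hom_inv_id, Category.comp_id]
    rw [h₁, reassoc_of% hsx, zero_comp]
  -- Since `g` factors through `K ⟶ L'`, the fibre `V x` is killed by `g`, so `s x` factors through
  -- the denominator and the fraction can be rewritten over `V x`.
  obtain ⟨b, hb⟩ : ∃ b : V x ⟶ r.X', s x = b ≫ r.s := Triangle.coyoneda_exact₂ _ hT (s x) hsg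
  refine ⟨⟨x, b ≫ r.f⟩, ?_⟩
  change inv (W.Q.map (s x)) ≫ W.Q.map (b ≫ r.f) = _
  rw [IsIso.inv_comp_eq, hb, Functor.map_comp, Functor.map_comp, Category.assoc,
    MorphismProperty.RightFraction.map_s_comp_map]

end ExactStructure

theorem mainTheorem11 {C : Type u} [Category.{v} C] [Preadditive C] [HasZeroObject C]
    [HasBinaryBiproducts C] (E : ExactStructure C) (hwic : WeaklyIdempotentComplete C)
    (κ : Cardinal.{v}) (hκ : κ.IsRegular) (hE : E.HasExactChainColimits κ)
    (ψ : C → Cardinal.{v}) (hψ : E.IsSizeFunction ψ) (hψκ : E.ChainColimitsPreserve κ ψ) :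
    (∀ lam : Cardinal.{v}, lam.IsRegular → κ < lam →
      ∀ (K M : CochainComplex C ℤ) (g : K ⟶ M), (∀ n, ψ (K.X n) ≤ lam) → E.IsExactComplex M →
        ∃ (L : CochainComplex C ℤ) (k : K ⟶ L) (m : L ⟶ M),
          E.IsExactComplexIn (fun X => ψ X ≤ E.phiLower ψ lam κ.ord) L ∧ k ≫ m = g ∧
          (E.ChainColimitsAdmissible κ → ∀ n, E.IsAdmMono (m.f n))) ∧
    LocallySmall.{v} E.DerivedCat := by
  refine ⟨fun lam hlam hκlam K M g hK hM =>
    E.exists_factorization hwic hκ hE hψ hψκ hlam hκlam g hK hM, ⟨fun X Y => ?_⟩⟩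
  obtain ⟨K, hK⟩ := HomotopyCategory.quotient_obj_surjective (E.acyclic.trW.Q.objPreimage X)
  have := E.small_hom hwic hκ hE hψ hψκ K (E.acyclic.trW.Q.objPreimage Y)
  rw [hK] at this
  exact small_map (Iso.homCongr (E.acyclic.trW.Q.objObjPreimageIso X)
    (E.acyclic.trW.Q.objObjPreimageIso Y)).symm
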